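/- Let $Q$ be a smooth finite-dimensional manifold without boundary. A non-holonomic Lagrangian problem $(L,C,D,F)$ on $Q$ consists of: a smooth Lagrangian $L\colon TQ\to\mathbb R$ that is regular (its fibre Hessian $\partial^2L/\partial v^i\partial v^j$ is everywhere nondegenerate); an embedded submanifold $C\subset TQ$; a smooth vector subbundle $D\subset T_C(TQ)$ along $C$ with $D\subset TC$ (the field of permitted directions); and a smooth vector subbundle $F\subset T^*_C(TQ)$ along $C$ (the reaction forces) whose elements are horizontal, $S^*(F)=0$, where $S=\frac{\partial}{\partial v^i}\otimes dq^i$ is the vertical endomorphism of $T(TQ)$. Write $\Delta=v^i\,\partial/\partial v^i$, $\Theta_L=S^*(dL)$, $\omega_L=-d\Theta_L$, $E_L=\Delta(L)-L$; let $\Gamma_L$ be the vector field with $i_{\Gamma_L}\omega_L=dE_L$, let $\hat\omega_L(v)=i_v\omega_L$, $\Lambda_L(a,b)=\omega_L(\hat\omega_L^{-1}a,\hat\omega_L^{-1}b)$, and $\Lambda_L(F)=\hat\omega_L^{-1}(F)$. Let $\mathcal F_L\colon TQ\to T^*Q$ be the Legendre transformation (fibre derivative of $L$), and let $\alpha\colon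 T(T^*Q)\to T^*(TQ)$, $\alpha(q,p,\dot q,\dot p)=(q,\dot q,\dot p,p)$, be Tulczyjew's canonical map. Put $$E=\alpha^{-1}(dL+F),\qquad C^*=\tau_{T^*Q}(E),\qquad \hat D=T\mathcal F_L(D),$$ where $dL+F=\{dL(x)+f : x\in C,\ f\in F_x\}$ and $\tau_{T^*Q}\colon T(T^*Q)\to T^*Q$ is the projection. The adapted integrability algorithm starts with $E_0=E$, $C_0=C^*$, $\hat D_0=\hat D$ and continues with $$E_{k+1}=E_k\cap\hat D_k,\qquad C_{k+1}=\tau_{T^*Q}(E_{k+1}),\qquad \hat D_{k+1}=\hat D_k|_{C_{k+1}}\cap TC_{k+1}$$ (for a subset $S$ of a manifold, $TS$ is the set of velocities of smooth curves lying in $S$; this is the usual tangent bundle if $S$ is an embedded submanifold). Assume that $\hat D$ is a well-defined field of directions along $\mathcal F_L(C)$: if $x,y\in C$ and $\mathcal F_L(x)=\mathcal F_L(y)$, then $T\mathcal F_L(D_x)=T\mathcal F_L(D_y)$. (This is automatic if $\mathcal F_L|_C$ is injective, in particular if $L$ is hyperregular.) **Theorem.** Suppose that at every point of $C$ $$\operatorname{rank}F=\operatorname{corank}D\qquad\text{and}\qquad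 D^0\cap F^\perp=0,$$ where $D^0\subset T_C^*(TQ)$ is the annihilator of $D$ and $F^\perp=\{f\in T_C^*(TQ) : \Lambda_L(f,F)=0\}$. Then: 1. $L$, $D$ and $F$ are compatible, i.e. the adapted integrability algorithm stops at the first step: $E_k=E\cap\hat D$, $C_k=C^*$ and $\hat D_k=\hat D$ for all $k\ge1$. Moreover $C^*=\mathcal F_L(C)$. 2. The implicit differential equation $E\cap\hat D=\alpha^{-1}(dL+F)\cap T\mathcal F_L(D)$ is integrable: each of its points lies on the tangent lift of a smooth curve in $T^*Q$, defined on an open interval, all of whose tangent vectors belong to $E\cap\hat D$. 3. There is a smooth vector field $\Gamma$ along $C$ which is a SODE ($S(\Gamma)=\Delta$), satisfies $\Gamma\in\Gamma_L+\Lambda_L(F)$, takes values in $D$, and whose graph, transported to $T(T^*Q)$ by the Legendre transformation, is this equation: $$\{T\mathcal F_L(\Gamma(x)) : x\in C\}=\alpha^{-1}(dL+F)\cap T\mathcal F_L(D).$$ It is unique: it is the only vector field along $C$ that takes values in $D$ and lies in $\Gamma_L+\Lambda_L(F)$, and it is the only SODE along $C$ whose transported graph is $\alpha^{-1}(dL+F)\cap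 T\mathcal F_L(D)$. -/

import Mathlib

open Set Bundle
open scoped Manifold ContDiff

noncomputable section

namespace NonHolonomic

section General

variable {E : Type*} [NormedAddCommGroup E] [NormedSpace ℝ E] {H : Type*} [TopologicalSpace H]

/-- The cotangent space of a manifold at a point. -/
abbrev CotangentSpace (I : ModelWithCorners ℝ E H) {M : Type*} [TopologicalSpace M]
    [ChartedSpace H M] (x : M) : Type _ := TangentSpace I x →L[ℝ] ℝ

/-- The cotangent bundle of a manifold, with Mathlib's topology and manifold structure on the
bundle of continuous linear maps from the tangent bundle to the trivial bundle. -/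
abbrev CotangentBundle (I : ModelWithCorners ℝ E H) (M : Type*) [TopologicalSpace M]
    [ChartedSpace H M] : Type _ :=
  TotalSpace (E →L[ℝ] ℝ) (fun x : M => CotangentSpace I x)

variable (I : ModelWithCorners ℝ E H) {M : Type*} [TopologicalSpace M] [ChartedSpace H M]

/-- The identification of `T_x M` with the model vector space by the coordinates
`v^i = dx^i(v)` of the preferred chart at `x`.  (In Mathlib the tangent space is by definition a
copy of the model space, a tangent vector being represented by these coordinates.) -/
def tangentCoord (x : M) : TangentSpace I x ≃L[ℝ] E := ContinuousLinearEquiv.refl ℝ E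

/-- `S` is an embedded smooth submanifold of the manifold `M` (without boundary): around each of
its points there is a chart of the maximal atlas that maps `S` onto a linear slice. -/
def IsEmbeddedSubmanifold (S : Set M) : Prop :=
  ∀ x ∈ S, ∃ φ ∈ IsManifold.maximalAtlas I ∞ M, x ∈ φ.source ∧
    ∃ K : Submodule ℝ E, ∀ y ∈ φ.source, (y ∈ S ↔ I (φ y) ∈ K)

/-- The tangent bundle `TS ⊆ TM` of a subset `S` of `M`: the set of all velocities of smooth
curves that lie in `S`.  For an embedded submanifold it is the usual tangent bundle. -/
def tangentSet (S : Set M) : Set (TangentBundle I M) :=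
  {w | ∃ γ : ℝ → M, ContMDiff 𝓘(ℝ, ℝ) I ∞ γ ∧ (∀ t, γ t ∈ S) ∧
    tangentMap 𝓘(ℝ, ℝ) I γ ⟨0, (tangentCoord 𝓘(ℝ, ℝ) 0).symm 1⟩ = w}

/-- The family of linear subspaces `V x` of the fibres of a vector bundle is a smooth vector
subbundle along `S`: around each point of `S` it has a smooth local frame. -/
def IsSmoothSubbundleAlong {F : Type*} [NormedAddCommGroup F] [NormedSpace ℝ F] {W : M → Type*}
    [TopologicalSpace (TotalSpace F W)] [∀ x, AddCommGroup (W x)] [∀ x, Module ℝ (W x)]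
    [∀ x, TopologicalSpace (W x)] [FiberBundle F W]
    (S : Set M) (V : ∀ x, Submodule ℝ (W x)) : Prop :=
  ∀ x ∈ S, ∃ U : Set M, IsOpen U ∧ x ∈ U ∧ ∃ (k : ℕ) (s : Fin k → ∀ y, W y),
    (∀ i, ContMDiffOn I (I.prod 𝓘(ℝ, F)) ∞ (fun y => TotalSpace.mk' F y (s i y)) (U ∩ S)) ∧
    ∀ y ∈ U ∩ S, LinearIndependent ℝ (fun i => s i y) ∧
      Submodule.span ℝ (Set.range fun i => s i y) = V y

/-- The expression, in the preferred chart at `x`, of a 1-form `θ` on a manifold without boundary: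
the pull-back of `θ` by the inverse of the chart. -/
def oneFormInChart (θ : ∀ x : M, CotangentSpace I x) (x : M) (y : E) : E →L[ℝ] ℝ :=
  (θ ((extChartAt I x).symm y)).comp ((mfderiv 𝓘(ℝ, E) I (extChartAt I x).symm y).comp
    ((tangentCoord 𝓘(ℝ, E) y).symm : E →L[ℝ] TangentSpace 𝓘(ℝ, E) y))

/-- The exterior derivative of a 1-form on a manifold without boundary,
`dθ(u, w) = ∂_u θ(w) - ∂_w θ(u)`, computed at `x` in the preferred chart at `x`. -/
def extDerivOneForm (θ : ∀ x : M, CotangentSpace I x) (x : M) :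
    TangentSpace I x →L[ℝ] CotangentSpace I x :=
  let A : E →L[ℝ] E →L[ℝ] ℝ := fderiv ℝ (oneFormInChart I θ x) (extChartAt I x x)
  (A - A.flip : E →L[ℝ] E →L[ℝ] ℝ)

/-- The differential of a function, as a 1-form. -/
def differential (f : M → ℝ) (x : M) : CotangentSpace I x :=
  ((tangentCoord 𝓘(ℝ, ℝ) (f x) : TangentSpace 𝓘(ℝ, ℝ) (f x) →L[ℝ] ℝ)).comp
    (mfderiv I 𝓘(ℝ, ℝ) f x)

/-- The annihilator `D^0 ⊆ T_x^* M` of a subspace `D` of `T_x M`. -/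
def annihilator {x : M} (D : Submodule ℝ (TangentSpace I x)) :
    Submodule ℝ (CotangentSpace I x) where
  carrier := {a | ∀ w ∈ D, a w = 0}
  add_mem' := by
    intro a b ha hb w hw
    simp [ha w hw, hb w hw]
  zero_mem' := by
    intro w _
    simp
  smul_mem' := by
    intro c a ha w hw
    simp [ha w hw]

/-- The implicit differential equation `X ⊆ TM` is integrable: every point of `X` is on
the tangent lift of a solution, that is, of a smooth curve, defined on an open interval, whose
tangent vectors are all in `X`. -/
def IsIntegrableEquation (X : Set (TangentBundle I M)) : Prop :=
  ∀ z ∈ X, ∃ ε > (0 : ℝ), ∃ γ : ℝ → M, ContMDiffOn 𝓘(ℝ, ℝ) I ∞ γ (Ioo (-ε) ε) ∧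
    (∀ t ∈ Ioo (-ε) ε, tangentMap 𝓘(ℝ, ℝ) I γ ⟨t, (tangentCoord 𝓘(ℝ, ℝ) t).symm 1⟩ ∈ X) ∧
    tangentMap 𝓘(ℝ, ℝ) I γ ⟨0, (tangentCoord 𝓘(ℝ, ℝ) 0).symm 1⟩ = z

end General

section Lagrangian

variable {E : Type*} [NormedAddCommGroup E] [NormedSpace ℝ E]
  {Q : Type*} [TopologicalSpace Q] [ChartedSpace E Q]

/-- The tangent bundle `TQ` of the configuration space. -/
abbrev TQ (E : Type*) [NormedAddCommGroup E] [NormedSpace ℝ E] (Q : Type*) [TopologicalSpace Q]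
    [ChartedSpace E Q] : Type _ := TangentBundle 𝓘(ℝ, E) Q

/-- The cotangent bundle `T^*Q` of the configuration space. -/
abbrev TstarQ (E : Type*) [NormedAddCommGroup E] [NormedSpace ℝ E] (Q : Type*)
    [TopologicalSpace Q] [ChartedSpace E Q] : Type _ := CotangentBundle 𝓘(ℝ, E) Q

/-- The base coordinates in a preferred chart of the total space of a bundle over `Q` are those of
the preferred chart of `Q`. -/
theorem extChartAt_proj_eq_fst {F : Type*} [NormedAddCommGroup F] [NormedSpace ℝ F] {W : Q → Type*}
    [TopologicalSpace (TotalSpace F W)] [∀ x, TopologicalSpace (W x)] [FiberBundle F W] (x : TotalSpace F W) (y : E × F)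
   (hy : y ∈ (extChartAt (𝓘(ℝ, E).prod 𝓘(ℝ, F)) x).target) :
    extChartAt 𝓘(ℝ, E) x.proj (((extChartAt (𝓘(ℝ, E).prod 𝓘(ℝ, F)) x).symm y).proj) = y.1 := by
  rw [FiberBundle.extChartAt_target] at hy
  obtain ⟨⟨h1, h2⟩, -⟩ := hy
  rw [FiberBundle.extChartAt]
  have : (((trivializationAt F W x.proj).toPartialEquiv ≫
        (extChartAt 𝓘(ℝ, E) x.proj).prod (PartialEquiv.refl F)).symm y).proj = (extChartAt 𝓘(ℝ, E) x.proj).symm y.1 :=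
    (trivializationAt F W x.proj).proj_symm_apply' (b := (extChartAt 𝓘(ℝ, E) x.proj).symm y.1) (x := y.2) h2
  rw [this]
  exact (extChartAt 𝓘(ℝ, E) x.proj).right_inv h1

/-- In the coordinates `tangentCoord` of the total space of a bundle over `Q` (such as `TQ` and
`T^*Q`), the differential of the projection is `(q̇, ·) ↦ q̇`. -/
theorem hasMFDerivAt_proj_coord {F : Type*} [NormedAddCommGroup F] [NormedSpace ℝ F] {W : Q → Type*}
    [TopologicalSpace (TotalSpace F W)] [∀ x, TopologicalSpace (W x)] [FiberBundle F W] (x : TotalSpace F W)  :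
    HasMFDerivAt (𝓘(ℝ, E).prod 𝓘(ℝ, F)) 𝓘(ℝ, E) (TotalSpace.proj : TotalSpace F W → Q) x
      (((tangentCoord 𝓘(ℝ, E) x.proj).symm : E →L[ℝ] TangentSpace 𝓘(ℝ, E) x.proj).comp
        ((ContinuousLinearMap.fst ℝ E F).comp
          (tangentCoord (𝓘(ℝ, E).prod 𝓘(ℝ, F)) x : _ →L[ℝ] E × F))) := by
  refine ⟨(FiberBundle.continuous_proj F W).continuousAt, ?_⟩
  have h : HasFDerivWithinAt (Prod.fst : E × F → E) (ContinuousLinearMap.fst ℝ E F)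
      (Set.range (𝓘(ℝ, E).prod 𝓘(ℝ, F))) (extChartAt (𝓘(ℝ, E).prod 𝓘(ℝ, F)) x x) := hasFDerivWithinAt_fst
  refine h.congr_of_eventuallyEq ?_ (extChartAt_proj_eq_fst x _ (mem_extChartAt_target x))
  filter_upwards [extChartAt_target_mem_nhdsWithin (I := 𝓘(ℝ, E).prod 𝓘(ℝ, F)) x] with y hy
  exact extChartAt_proj_eq_fst x y hy

variable [IsManifold 𝓘(ℝ, E) ∞ Q]

/-- The model with corners of the manifold `TQ`. -/
abbrev modelTQ (E : Type*) [NormedAddCommGroup E] [NormedSpace ℝ E] :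
    ModelWithCorners ℝ (E × E) (ModelProd E E) := 𝓘(ℝ, E).prod 𝓘(ℝ, E)

/-- The model with corners of the manifold `T^*Q`. -/
abbrev modelTstarQ (E : Type*) [NormedAddCommGroup E] [NormedSpace ℝ E] :
    ModelWithCorners ℝ (E × (E →L[ℝ] ℝ)) (ModelProd E (E →L[ℝ] ℝ)) :=
  𝓘(ℝ, E).prod 𝓘(ℝ, E →L[ℝ] ℝ)

variable (E Q) in
/-- The double tangent bundle `T(TQ)`. -/
abbrev TTQ : Type _ := TangentBundle (modelTQ E) (TQ E Q)

variable (E Q) in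
/-- The bundle `T(T^*Q)`. -/
abbrev TTstarQ : Type _ := TangentBundle (modelTstarQ E) (TstarQ E Q)

variable (E Q) in
/-- The bundle `T^*(TQ)`. -/
abbrev TstarTQ : Type _ := CotangentBundle (modelTQ E) (TQ E Q)

/-! The preferred chart of `TQ` (of `T^*Q`) at a point over `q` is the natural chart
`(q^i, v^i)` (resp. `(q^i, p_i)`) that is induced by the preferred chart `(q^i)` of `Q` at `q`.
Hence `tangentCoord (modelTQ E) x : T_x(TQ) ≃ E × E` gives the natural coordinates
`(q̇^i, v̇^i)` and `tangentCoord (modelTstarQ E) p : T_p(T^*Q) ≃ E × E^*` the natural coordinates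
`(q̇^i, ṗ_i)`. The lemmas `hasMFDerivAt_proj_coord`,
`hasMFDerivAt_fibre_coord` and `verticalEndo_eq` confirm this. -/

/-- The preferred chart of `TQ` at `x` is linear on the fibre through `x`. -/
theorem extChartAt_fibre (x : TQ E Q) (w : E) : (extChartAt (modelTQ E) x) (⟨x.proj, (tangentCoord 𝓘(ℝ, E) x.proj).symm w⟩ : TQ E Q) = (extChartAt 𝓘(ℝ, E) x.proj x.proj, w) := by
    rw [FiberBundle.extChartAt]
    refine Prod.ext rfl ?_
    exact (tangentBundleCore 𝓘(ℝ, E) Q).coordChange_self (achart _ x.1) x.1 (mem_achart_source E x.1) w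

/-- In the coordinates `tangentCoord` of `TQ`, the differential of the inclusion of the fibre
`T_q Q → TQ` (the vertical lift) is `v̇ ↦ (0, v̇)`. -/
theorem hasMFDerivAt_fibre_coord (x : TQ E Q) :
    HasMFDerivAt 𝓘(ℝ, E) (modelTQ E)
      (fun w : E => (⟨x.proj, (tangentCoord 𝓘(ℝ, E) x.proj).symm w⟩ : TQ E Q))
      (tangentCoord 𝓘(ℝ, E) x.proj x.2)
      (((tangentCoord (modelTQ E) x).symm : E × E →L[ℝ] TangentSpace (modelTQ E) x).comp
        ((ContinuousLinearMap.inr ℝ E E).comp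
          (tangentCoord 𝓘(ℝ, E) (tangentCoord 𝓘(ℝ, E) x.proj x.2) : _ →L[ℝ] E))) := by
  refine ⟨(FiberBundle.continuous_totalSpaceMk E (TangentSpace 𝓘(ℝ, E)) x.proj).continuousAt, ?_⟩
  have h : HasFDerivWithinAt (fun w : E => (extChartAt 𝓘(ℝ, E) x.proj x.proj, w)) (ContinuousLinearMap.inr ℝ E E) (Set.range 𝓘(ℝ, E))
     (tangentCoord 𝓘(ℝ, E) x.proj x.2) :=
    (hasFDerivAt_prodMk_right _ _).hasFDerivWithinAt
  exact h.congr_of_eventuallyEq (Filter.Eventually.of_forall fun w => extChartAt_fibre x w) (extChartAt_fibre x _)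

/-- The vertical endomorphism `S = ∂/∂v^i ⊗ dq^i` of `T(TQ)`. -/
def verticalEndo (x : TQ E Q) :
    TangentSpace (modelTQ E) x →L[ℝ] TangentSpace (modelTQ E) x :=
  ((tangentCoord (modelTQ E) x).symm : E × E →L[ℝ] TangentSpace (modelTQ E) x).comp
    ((((0 : E × E →L[ℝ] E).prod (ContinuousLinearMap.fst ℝ E E))).comp
      (tangentCoord (modelTQ E) x : TangentSpace (modelTQ E) x →L[ℝ] E × E))

/-- `S` is the vertical lift of the differential of the projection `TQ → Q`. -/
theorem verticalEndo_eq (x : TQ E Q) (u : TangentSpace (modelTQ E) x) :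
   verticalEndo x u = mfderiv 𝓘(ℝ, E) (modelTQ E)
      (fun w : E => (⟨x.proj, (tangentCoord 𝓘(ℝ, E) x.proj).symm w⟩ : TQ E Q))
      (tangentCoord 𝓘(ℝ, E) x.proj x.2) ((tangentCoord 𝓘(ℝ, E) _).symm (tangentCoord 𝓘(ℝ, E) x.proj (mfderiv (modelTQ E) 𝓘(ℝ, E) (TotalSpace.proj : TQ E Q → Q) x u))) := by
  rw [(hasMFDerivAt_fibre_coord x).mfderiv, (hasMFDerivAt_proj_coord x).mfderiv]
  rfl

/-- The Liouville vector field `Δ = v^i ∂/∂v^i` of `TQ`. -/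
def liouville (x : TQ E Q) : TangentSpace (modelTQ E) x :=
  (tangentCoord (modelTQ E) x).symm (0, tangentCoord 𝓘(ℝ, E) x.proj x.2)

/-- The restriction of `L` to the fibre `T_q Q`. -/
def fibreRestrict (L : TQ E Q → ℝ) (q : Q) (u : E) : ℝ :=
  L ⟨q, (tangentCoord 𝓘(ℝ, E) q).symm u⟩

/-- The Legendre transformation `TQ → T^*Q`, i.e. the fibre derivative of `L`. -/
def legendre (L : TQ E Q → ℝ) (x : TQ E Q) : TstarQ E Q :=
  ⟨x.proj, (fderiv ℝ (fibreRestrict L x.proj) (tangentCoord 𝓘(ℝ, E) x.proj x.2)).comp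
    (tangentCoord 𝓘(ℝ, E) x.proj : TangentSpace 𝓘(ℝ, E) x.proj →L[ℝ] E)⟩

/-- `L` is regular: its fibre Hessian `∂²L/∂v^i∂v^j` is everywhere nondegenerate. -/
def IsRegular (L : TQ E Q → ℝ) : Prop :=
  ∀ (q : Q) (v w : E), (∀ u, fderiv ℝ (fderiv ℝ (fibreRestrict L q)) v w u = 0) → w = 0

/-- The Poincaré–Cartan 1-form `Θ_L = S^*(dL)`. -/
def cartanOneForm (L : TQ E Q → ℝ) (x : TQ E Q) : CotangentSpace (modelTQ E) x :=
  (differential (modelTQ E) L x).comp (verticalEndo x)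

/-- The Cartan 2-form `ω_L = -dΘ_L`, as the map `v ↦ i_v ω_L` from `T(TQ)` to `T^*(TQ)`. -/
def cartanTwoForm (L : TQ E Q → ℝ) (x : TQ E Q) :
    TangentSpace (modelTQ E) x →L[ℝ] CotangentSpace (modelTQ E) x :=
  -extDerivOneForm (modelTQ E) (cartanOneForm L) x

/-- The energy `E_L = Δ(L) - L`. -/
def energy (L : TQ E Q → ℝ) (x : TQ E Q) : ℝ :=
  differential (modelTQ E) L x (liouville x) - L x

/-- The map `T^*(TQ) → T(TQ)` defined by the Poisson tensor, i.e. the inverse of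
`v ↦ i_v ω_L` (which is invertible when `L` is regular). -/
def poissonSharp (L : TQ E Q → ℝ) (x : TQ E Q) :
    CotangentSpace (modelTQ E) x →L[ℝ] TangentSpace (modelTQ E) x :=
  (cartanTwoForm L x).inverse

/-- The Poisson tensor `Λ_L(a, b) = ω_L(ω_L^{-1} a, ω_L^{-1} b)`. -/
def poissonTensor (L : TQ E Q → ℝ) (x : TQ E Q) (a b : CotangentSpace (modelTQ E) x) : ℝ :=
  cartanTwoForm L x (poissonSharp L x a) (poissonSharp L x b)

/-- The Euler–Lagrange vector field `Γ_L`, defined by `i_{Γ_L} ω_L = dE_L`. -/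
def eulerLagrangeField (L : TQ E Q → ℝ) (x : TQ E Q) : TangentSpace (modelTQ E) x :=
  poissonSharp L x (differential (modelTQ E) (energy L) x)

/-- The orthogonal `F^⊥ = {f | Λ_L(f, F) = 0}` of a subspace `F` of `T_x^*(TQ)`. -/
def poissonOrthogonal (L : TQ E Q → ℝ) {x : TQ E Q}
    (F : Submodule ℝ (CotangentSpace (modelTQ E) x)) :
    Submodule ℝ (CotangentSpace (modelTQ E) x) where
  carrier := {f | ∀ g ∈ F, poissonTensor L x f g = 0}
  add_mem' := by
    intro a b ha hb g hg
    have h1 := ha g hg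
    have h2 := hb g hg
    simp only [poissonTensor] at h1 h2 ⊢
    simp [h1, h2]
  zero_mem' := by
    intro g _
    simp [poissonTensor]
  smul_mem' := by
    intro c a ha g hg
    have h1 := ha g hg
    simp only [poissonTensor] at h1 ⊢
    simp [h1]

/-- Tulczyjew's canonical map `α : T(T^*Q) → T^*(TQ)`; in natural coordinates
`α(q, p, q̇, ṗ) = (q, q̇, ṗ, p)`, i.e. `α(q, p, q̇, ṗ)` is the covector `ṗ_i dq^i + p_i dv^i` at
the point `(q, q̇)` of `TQ`. -/
def tulczyjew (z : TTstarQ E Q) : TstarTQ E Q :=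
  let q : Q := z.proj.proj
  let p : E →L[ℝ] ℝ := z.proj.2.comp
    ((tangentCoord 𝓘(ℝ, E) q).symm : E →L[ℝ] TangentSpace 𝓘(ℝ, E) q)
  let c : E × (E →L[ℝ] ℝ) := tangentCoord (modelTstarQ E) z.proj z.2
  let x : TQ E Q := ⟨q, (tangentCoord 𝓘(ℝ, E) q).symm c.1⟩
  ⟨x, (c.2.coprod p).comp
    (tangentCoord (modelTQ E) x : TangentSpace (modelTQ E) x →L[ℝ] E × E)⟩

variable (E Q) in
/-- A non-holonomic Lagrangian problem `(L, C, D, F)`. The values of `D` and `F` outside `C` are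
irrelevant. -/
structure Problem where
  /-- the Lagrangian -/
  L : TQ E Q → ℝ
  smooth_L : ContMDiff (modelTQ E) 𝓘(ℝ, ℝ) ∞ L
  regular_L : IsRegular L
  /-- the constraint submanifold -/
  C : Set (TQ E Q)
  submanifold_C : IsEmbeddedSubmanifold (modelTQ E) C
  /-- the field of permitted directions along `C` -/
  D : ∀ x : TQ E Q, Submodule ℝ (TangentSpace (modelTQ E) x)
  subbundle_D : IsSmoothSubbundleAlong (modelTQ E) (F := E × E) C D
  D_tangent : ∀ x ∈ C, ∀ w ∈ D x, (⟨x, w⟩ : TTQ E Q) ∈ tangentSet (modelTQ E) C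
  /-- the bundle of reaction forces along `C` -/
  F : ∀ x : TQ E Q, Submodule ℝ (CotangentSpace (modelTQ E) x)
  subbundle_F : IsSmoothSubbundleAlong (modelTQ E) (F := E × E →L[ℝ] ℝ) C F
  F_horizontal : ∀ x ∈ C, ∀ f ∈ F x, f.comp (verticalEndo x) = 0

namespace Problem

variable (P : Problem E Q)

/-- The tangent map `T F_L : T(TQ) → T(T^*Q)` of the Legendre transformation. -/
def tangentLegendre : TTQ E Q → TTstarQ E Q :=
  tangentMap (modelTQ E) (modelTstarQ E) (legendre P.L)

/-- The total space of the part of `D` over the point `x`, as a subset of `T(TQ)`. -/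
def fibreD (x : TQ E Q) : Set (TTQ E Q) := {w | ∃ u ∈ P.D x, w = ⟨x, u⟩}

/-- `D̂ = T F_L (D) ⊆ T(T^*Q)`, the permitted directions on `T^*Q`. -/
def Dhat : Set (TTstarQ E Q) := P.tangentLegendre '' {w | w.proj ∈ P.C ∧ w.2 ∈ P.D w.proj}

/-- The affine subbundle `dL + F ⊆ T^*(TQ)` along `C`. -/
def dLplusF : Set (TstarTQ E Q) :=
  {η | η.proj ∈ P.C ∧ ∃ f ∈ P.F η.proj, η.2 = differential (modelTQ E) P.L η.proj + f}

/-- The implicit differential equation `E = α⁻¹(dL + F) ⊆ T(T^*Q)` of the problem. -/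
def equation : Set (TTstarQ E Q) := tulczyjew ⁻¹' P.dLplusF

/-- `C^*`, the projection of `E` to `T^*Q`. -/
def Cstar : Set (TstarQ E Q) := TotalSpace.proj '' P.equation

/-- The adapted integrability algorithm: the triple `(E_k, C_k, D̂_k)` after `k` steps, where
`E_0 = E`, `C_0 = C^*`, `D̂_0 = D̂` and `E_{k+1} = E_k ∩ D̂_k`, `C_{k+1} = τ(E_{k+1})`,
`D̂_{k+1} = D̂_k|_{C_{k+1}} ∩ T C_{k+1}`. -/
def algorithm : ℕ → Set (TTstarQ E Q) × Set (TstarQ E Q) × Set (TTstarQ E Q)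
  | 0 => (P.equation, P.Cstar, P.Dhat)
  | k + 1 =>
    let E' := (algorithm k).1 ∩ (algorithm k).2.2
    let C' : Set (TstarQ E Q) := TotalSpace.proj '' E'
    (E', C', {z ∈ (algorithm k).2.2 | z.proj ∈ C'} ∩ tangentSet (modelTstarQ E) C')

/-- `L`, `D` and `F` are compatible: the adapted integrability algorithm stops at the first step,
`E_k = E ∩ D̂`, `C_k = C^*` and `D̂_k = D̂` for all `k ≥ 1`. -/
def Compatible : Prop :=
  ∀ k ≥ 1, P.algorithm k = (P.equation ∩ P.Dhat, P.Cstar, P.Dhat)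

/-- `D̂` is a well defined field of directions along `F_L(C)`: points of `C` with the same
Legendre transform have the same transformed permitted directions. -/
def DhatWellDefined : Prop :=
  ∀ x ∈ P.C, ∀ y ∈ P.C, legendre P.L x = legendre P.L y →
    P.tangentLegendre '' P.fibreD x = P.tangentLegendre '' P.fibreD y

variable (Γ : ∀ x : TQ E Q, TangentSpace (modelTQ E) x)

/-- The vector field `Γ` along `C` is smooth. -/
def IsSmoothAlong : Prop :=
  ContMDiffOn (modelTQ E) ((modelTQ E).prod 𝓘(ℝ, E × E)) ∞ (fun x => (⟨x, Γ x⟩ : TTQ E Q)) P.C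

/-- The vector field `Γ` along `C` is of second order: `S(Γ) = Δ`. -/
def IsSODE : Prop := ∀ x ∈ P.C, verticalEndo x (Γ x) = liouville x

/-- `Γ` is, along `C`, of the form `Γ_L + Λ_L(f)` with a reaction force `f`. -/
def IsReactionModification : Prop :=
  ∀ x ∈ P.C, ∃ f ∈ P.F x, Γ x = eulerLagrangeField P.L x + poissonSharp P.L x f

/-- `Γ` lies, along `C`, in the permitted directions. -/
def IsPermitted : Prop := ∀ x ∈ P.C, Γ x ∈ P.D x

/-- The graph of `Γ` along `C`, transported to `T(T^*Q)` by the Legendre transformation. -/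
def legendreGraph : Set (TTstarQ E Q) := (fun x => P.tangentLegendre ⟨x, Γ x⟩) '' P.C

end Problem

end Lagrangian

end NonHolonomic

end

noncomputable section

namespace NonHolonomic

/-! In natural coordinates `ω_L = dq^i ∧ d(∂L/∂v^i)`. If `f` is horizontal and `i_u ω_L = dE_L + f`,
then testing on vertical vectors and using regularity shows that `u` is of second order; the
remaining components are the Euler–Lagrange equations with force, which say exactly that `α(T
F_L(u)) = dL - f` (`tulczyjew_tangentMap_legendre`). Since `α` is injective, `E` is the image under
`T F_L` of the affine family `Γ_L + Λ_L(F)` along `C` (`mem_equation_iff`), and `C^* = F_L(C)`.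

Because `Λ_L(a, g) = a(Λ_L(g))`, the condition `D^0 ∩ F^⊥ = 0` says that no nonzero covector
annihilates `D + Λ_L(F)`; with the rank condition this makes `Λ_L(F)` a complement of `D`
(`isCompl_map_poissonSharp`). So `Γ_L + Λ_L(F)` meets `D` in exactly one vector `Γ(x)` at each `x ∈
C`: the projection of `Γ_L` to `D` along `Λ_L(F)`.

Everything follows from this field. Its transported graph is `E ∩ D̂`, because `T F_L` is injective
on each tangent space and `D̂` is well defined (`legendreGraph_eq`). The graph projects onto all of
`C^*`, and curves in `C` tangent to `D` are pushed to curves in `C^*`, so the algorithm is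
stationary (`compatible`). Smoothness of `Γ` comes from solving a linear system with smooth
coefficients in local frames of `D` and `F` (`isSmoothAlong`). As `D ⊆ TC`, `Γ` has integral curves
in `C`, and the Legendre map carries them to solutions (`isIntegrableEquation_legendreGraph`). -/

theorem one_le_infty : (1 : ℕ∞ω) ≤ ∞ := by exact_mod_cast le_top

theorem two_le_infty : (2 : ℕ∞ω) ≤ ∞ :=
  WithTop.coe_le_coe.2 (le_top : (2 : ℕ∞) ≤ ⊤)

/-! ### Exterior derivative of 1-forms and change of charts. -/

/-- The exterior derivative of 1-forms on a vector space commutes with pull-backs. -/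
theorem fderiv_pullback_antisymm {E : Type*} [NormedAddCommGroup E] [NormedSpace ℝ E]
    {θ θ₀ : E → E →L[ℝ] ℝ} {τ : E → E} {y : E} (hτ : ContDiffAt ℝ ∞ τ y)
    (hθ : DifferentiableAt ℝ θ₀ (τ y))
    (h : ∀ᶠ z in nhds y, θ z = (θ₀ (τ z)).comp (fderiv ℝ τ z)) (u w : E) :
    fderiv ℝ θ y u w - fderiv ℝ θ y w u =
      fderiv ℝ θ₀ (τ y) (fderiv ℝ τ y u) (fderiv ℝ τ y w) -
        fderiv ℝ θ₀ (τ y) (fderiv ℝ τ y w) (fderiv ℝ τ y u) := by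
  have hd : HasFDerivAt τ (fderiv ℝ τ y) y := (hτ.differentiableAt (by simp)).hasFDerivAt
  have hd2 : HasFDerivAt (fderiv ℝ τ) (fderiv ℝ (fderiv ℝ τ) y) y :=
    ((hτ.fderiv_right (m := 1) two_le_infty).differentiableAt (by simp)).hasFDerivAt
  -- The product rule gives one term with the second derivative of `τ`; being symmetric in `u`, `w`,
  -- it cancels on antisymmetrisation.
  have hsymm : fderiv ℝ (fderiv ℝ τ) y u w = fderiv ℝ (fderiv ℝ τ) y w u :=
    hτ.isSymmSndFDerivAt (by simpa using two_le_infty) u w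
  have hA := ((hθ.hasFDerivAt.comp _ hd).clm_comp hd2).congr_of_eventuallyEq h
  rw [hA.fderiv]
  simp [hsymm]

section Forms

variable {E : Type*} [NormedAddCommGroup E] [NormedSpace ℝ E] {H : Type*} [TopologicalSpace H]
  (I : ModelWithCorners ℝ E H) {M : Type*} [TopologicalSpace M] [ChartedSpace H M]

/-- The covectors live in fibres over `f y` and `g y`, which are different types, so the derivative
is replaced before the base point. -/
theorem oneFormInChart_apply_of_eventuallyEq (θ : ∀ x : M, CotangentSpace I x) {f g : E → M} {y : E}
    (h : f =ᶠ[nhds y] g) (w : E) :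
    θ (f y) (mfderiv 𝓘(ℝ, E) I f y w) = θ (g y) (mfderiv 𝓘(ℝ, E) I g y w) := by
  have h1 : mfderiv 𝓘(ℝ, E) I f y = (mfderiv 𝓘(ℝ, E) I g y : E →L[ℝ] E) := h.mfderiv_eq
  rw [h1]
  have h2 := h.eq_of_nhds
  rw [h2]

variable [I.Boundaryless] [IsManifold I ∞ M]

theorem mdifferentiableAt_extChartAt_symm_of_mem (x : M) {y : E}
    (hy : y ∈ (extChartAt I x).target) :
    MDifferentiableAt 𝓘(ℝ, E) I (extChartAt I x).symm y := by
  have := (contMDiffOn_extChartAt_symm (I := I) (n := ∞) x)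
  exact ((this y hy).contMDiffAt ((isOpen_extChartAt_target x).mem_nhds hy)).mdifferentiableAt
    (by simp)

/-- The transition map between two preferred charts. -/
def chartTransition (x₀ x : M) (y : E) : E := extChartAt I x₀ ((extChartAt I x).symm y)

theorem contDiffAt_chartTransition {x₀ x : M} (hx : x ∈ (extChartAt I x₀).source) :
    ContDiffAt ℝ ∞ (chartTransition I x₀ x) (extChartAt I x x) := by
  have h1 : ContMDiffAt 𝓘(ℝ, E) I ∞ (extChartAt I x).symm (extChartAt I x x) :=
    (contMDiffOn_extChartAt_symm (I := I) (n := ∞) x _ (mem_extChartAt_target x)).contMDiffAt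
      (extChartAt_target_mem_nhds x)
  have h2 : ContMDiffAt I 𝓘(ℝ, E) ∞ (extChartAt I x₀)
      ((extChartAt I x).symm (extChartAt I x x)) := by
    rw [extChartAt_to_inv]
    exact contMDiffAt_extChartAt' (by rwa [extChartAt_source] at hx)
  exact (h2.comp _ h1).contDiffAt

theorem fderiv_chartTransition {x₀ x : M} (hx : x ∈ (extChartAt I x₀).source) :
    fderiv ℝ (chartTransition I x₀ x) (extChartAt I x x) =
      (mfderiv I 𝓘(ℝ, E) (extChartAt I x₀) x : E →L[ℝ] E) := by
  have h2 : MDifferentiableAt I 𝓘(ℝ, E) (extChartAt I x₀) x :=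
    (contMDiffAt_extChartAt' (n := ∞) (by rwa [extChartAt_source] at hx)).mdifferentiableAt
      (by simp)
  rw [h2.mfderiv]
  rw [I.range_eq_univ, fderivWithin_univ]
  rfl

/-- Chain rule for the inverse chart at `x` written as the inverse chart at `x₀` after the
transition map. It is needed on a neighbourhood because both sides will be differentiated. -/
theorem eventually_oneFormInChart_eq (θ : ∀ x : M, CotangentSpace I x) {x₀ x : M}
    (hx : x ∈ (extChartAt I x₀).source) : ∀ᶠ y in nhds (extChartAt I x x),
    oneFormInChart I θ x y = (oneFormInChart I θ x₀ (chartTransition I x₀ x y)).comp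
      (fderiv ℝ (chartTransition I x₀ x) y) := by
  have hd : ∀ᶠ y in nhds (extChartAt I x x), DifferentiableAt ℝ (chartTransition I x₀ x) y := by
    have := ((contDiffAt_chartTransition I hx).of_le one_le_infty).eventually (by simp)
    filter_upwards [this] with y hy
    exact hy.differentiableAt one_ne_zero
  have hs : ∀ᶠ y in nhds (extChartAt I x x), y ∈ (extChartAt I x).target ∧
      (extChartAt I x).symm y ∈ (extChartAt I x₀).source := by
    refine Filter.Eventually.and (extChartAt_target_mem_nhds x) ?_
    have hc := (continuousAt_extChartAt_symm (I := I) x)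
    refine hc ?_
    rw [extChartAt_to_inv]
    exact (isOpen_extChartAt_source x₀).mem_nhds hx
  filter_upwards [hd, hs.eventually_nhds] with y hy hsy
  have he : (extChartAt I x).symm =ᶠ[nhds y]
      fun y => (extChartAt I x₀).symm (chartTransition I x₀ x y) := by
    filter_upwards [hsy] with z hz
    exact ((extChartAt I x₀).left_inv hz.2).symm
  ext w
  have h1 := oneFormInChart_apply_of_eventuallyEq I θ he w
  refine h1.trans ?_
  have hsy' := hsy.self_of_nhds
  have hm : MDifferentiableAt 𝓘(ℝ, E) I (extChartAt I x₀).symm (chartTransition I x₀ x y) :=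
    mdifferentiableAt_extChartAt_symm_of_mem I x₀ ((extChartAt I x₀).map_source hsy'.2)
  have hcomp := mfderiv_comp y hm hy.mdifferentiableAt
  have hcomp' : mfderiv 𝓘(ℝ, E) I (fun y => (extChartAt I x₀).symm (chartTransition I x₀ x y)) y
    = _ := hcomp
  rw [hcomp', mfderiv_eq_fderiv]
  rfl

/-- The exterior derivative of a 1-form can be computed in any preferred chart. -/
theorem extDerivOneForm_eq (θ : ∀ x : M, CotangentSpace I x) {x₀ x : M}
    (hx : x ∈ (extChartAt I x₀).source)
    (hθ : DifferentiableAt ℝ (oneFormInChart I θ x₀) (extChartAt I x₀ x)) (u w : TangentSpace I x) :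
    extDerivOneForm I θ x u w =
      fderiv ℝ (oneFormInChart I θ x₀) (extChartAt I x₀ x)
        (mfderiv I 𝓘(ℝ, E) (extChartAt I x₀) x u) (mfderiv I 𝓘(ℝ, E) (extChartAt I x₀) x w) -
      fderiv ℝ (oneFormInChart I θ x₀) (extChartAt I x₀ x)
        (mfderiv I 𝓘(ℝ, E) (extChartAt I x₀) x w) (mfderiv I 𝓘(ℝ, E) (extChartAt I x₀) x u) := by
  have hv : chartTransition I x₀ x (extChartAt I x x) = extChartAt I x₀ x := by
    simp [chartTransition]
  rw [← hv] at hθ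
  have key := fderiv_pullback_antisymm (contDiffAt_chartTransition I hx) hθ
    (eventually_oneFormInChart_eq I θ hx)
  rw [hv, fderiv_chartTransition I hx] at key
  exact key u w

end Forms

/-- The cotangent trivialization is the transpose of the inverse tangent trivialization. -/
theorem cotangent_trivializationAt_apply {E : Type*} [NormedAddCommGroup E] [NormedSpace ℝ E]
    {H : Type*} [TopologicalSpace H] {I : ModelWithCorners ℝ E H} {M : Type*} [TopologicalSpace M]
    [ChartedSpace H M] [IsManifold I 1 M] (x₀ : M) (p : CotangentBundle I M) (a : E) :
    (trivializationAt (E →L[ℝ] ℝ) (fun x : M => CotangentSpace I x) x₀ p).2 a =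
      p.2 ((trivializationAt E (TangentSpace I) x₀).symmL ℝ p.proj a) := by
  rw [hom_trivializationAt_apply]
  simp [ContinuousLinearMap.inCoordinates]

/-! ### The Legendre map, the Cartan forms and the energy in natural coordinates. -/

section Coordinates

variable {E : Type*} [NormedAddCommGroup E] [NormedSpace ℝ E]
  {Q : Type*} [TopologicalSpace Q] [ChartedSpace E Q] [IsManifold 𝓘(ℝ, E) ∞ Q]

/-- The expression of a function on `TQ` in the preferred chart at `x₀`. -/
def inChart (f : TQ E Q → ℝ) (x₀ : TQ E Q) (y : E × E) : ℝ :=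
  f ((extChartAt (modelTQ E) x₀).symm y)

/-- The partial derivative of a function on `E × E` with respect to the second variable. -/
def fibreDeriv (f : E × E → ℝ) (y : E × E) : E →L[ℝ] ℝ :=
  (fderiv ℝ f y).comp (ContinuousLinearMap.inr ℝ E E)

theorem mem_target_TQ {x₀ : TQ E Q} {y : E × E} :
    y ∈ (extChartAt (modelTQ E) x₀).target ↔ y.1 ∈ (extChartAt 𝓘(ℝ, E) x₀.proj).target := by
  rw [FiberBundle.extChartAt_target]
  constructor
  · rintro ⟨⟨h, -⟩, -⟩
    exact h
  · intro h
    refine ⟨⟨h, ?_⟩, trivial⟩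
    have := (extChartAt 𝓘(ℝ, E) x₀.proj).map_target h
    rwa [extChartAt_source] at this

theorem mem_source_TQ {x₀ x : TQ E Q} :
    x ∈ (extChartAt (modelTQ E) x₀).source ↔ x.proj ∈ (chartAt E x₀.proj).source := by
  rw [FiberBundle.extChartAt]
  simp [PartialEquiv.trans_source]

/-- The inverse of the preferred chart of `TQ` is the tangent map of the inverse of the chart
of `Q`. -/
theorem extChartAt_symm_TQ {x₀ : TQ E Q} {y : E × E} (hy : y ∈ (extChartAt (modelTQ E) x₀).target) :
    (extChartAt (modelTQ E) x₀).symm y =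
      (⟨(extChartAt 𝓘(ℝ, E) x₀.proj).symm y.1,
        mfderiv 𝓘(ℝ, E) 𝓘(ℝ, E) (extChartAt 𝓘(ℝ, E) x₀.proj).symm y.1 y.2⟩ : TQ E Q) := by
  rw [mem_target_TQ] at hy
  have hs := (extChartAt 𝓘(ℝ, E) x₀.proj).map_target hy
  rw [extChartAt_source] at hs
  have h := TangentBundle.symmL_trivializationAt (I := 𝓘(ℝ, E)) hs
  rw [(extChartAt 𝓘(ℝ, E) x₀.proj).right_inv hy, ModelWithCorners.range_eq_univ,
    mfderivWithin_univ] at h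
  rw [FiberBundle.extChartAt, ← h]
  change (trivializationAt E (TangentSpace 𝓘(ℝ, E)) x₀.proj).toPartialEquiv.symm
    ((extChartAt 𝓘(ℝ, E) x₀.proj).symm y.1, y.2) = _
  have := (trivializationAt E (TangentSpace 𝓘(ℝ, E)) x₀.proj).mk_symm
    (b := (extChartAt 𝓘(ℝ, E) x₀.proj).symm y.1) hs y.2
  refine this.symm.trans (congrArg (TotalSpace.mk' E _) ?_)
  exact (Trivialization.symmL_apply (R := ℝ) _ hs y.2).symm

theorem fibreRestrict_eq (L : TQ E Q → ℝ) (x₀ : TQ E Q) {a : E}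
    (ha : a ∈ (extChartAt 𝓘(ℝ, E) x₀.proj).target) (w : E) :
    inChart L x₀ (a, w) = fibreRestrict L ((extChartAt 𝓘(ℝ, E) x₀.proj).symm a)
      (tangentCoord 𝓘(ℝ, E) _ (mfderiv 𝓘(ℝ, E) 𝓘(ℝ, E) (extChartAt 𝓘(ℝ, E) x₀.proj).symm a w)) := by
  rw [inChart, extChartAt_symm_TQ (mem_target_TQ.2 ha), fibreRestrict]
  rfl

variable {L : TQ E Q → ℝ}

theorem contDiffOn_inChart (hL : ContMDiff (modelTQ E) 𝓘(ℝ, ℝ) ∞ L) (x₀ : TQ E Q) :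
    ContDiffOn ℝ ∞ (inChart L x₀) (extChartAt (modelTQ E) x₀).target := by
  have h := hL.comp_contMDiffOn (contMDiffOn_extChartAt_symm (I := modelTQ E) (n := ∞) x₀)
  exact h.contDiffOn

theorem contDiffAt_inChart (hL : ContMDiff (modelTQ E) 𝓘(ℝ, ℝ) ∞ L) {x₀ : TQ E Q} {y : E × E}
    (hy : y ∈ (extChartAt (modelTQ E) x₀).target) : ContDiffAt ℝ ∞ (inChart L x₀) y :=
  (contDiffOn_inChart hL x₀).contDiffAt ((isOpen_extChartAt_target x₀).mem_nhds hy)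

theorem _root_.ContDiffAt.fibreDeriv {f : E × E → ℝ} {y : E × E} (hf : ContDiffAt ℝ ∞ f y) :
    ContDiffAt ℝ ∞ (fibreDeriv f) y :=
  (hf.fderiv_right (m := ∞) (by simp)).clm_comp contDiffAt_const

theorem differentiableAt_fibreRestrict (hL : ContMDiff (modelTQ E) 𝓘(ℝ, ℝ) ∞ L) (q : Q) (u : E) :
    DifferentiableAt ℝ (fibreRestrict L q) u := by
  have h := (hL.mdifferentiable (by simp)) ⟨q, (tangentCoord 𝓘(ℝ, E) q).symm u⟩
  have h' := (hasMFDerivAt_fibre_coord (⟨q, (tangentCoord 𝓘(ℝ, E) q).symm u⟩ :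
    TQ E Q)).mdifferentiableAt
  exact (h.comp u h').differentiableAt

/-- The Legendre transformation in coordinates. -/
theorem legendre_comp_mfderiv (hL : ContMDiff (modelTQ E) 𝓘(ℝ, ℝ) ∞ L) {x₀ : TQ E Q} {y : E × E}
    (hy : y ∈ (extChartAt (modelTQ E) x₀).target) (a : E) :
    (legendre L (⟨(extChartAt 𝓘(ℝ, E) x₀.proj).symm y.1,
        mfderiv 𝓘(ℝ, E) 𝓘(ℝ, E) (extChartAt 𝓘(ℝ, E) x₀.proj).symm y.1 y.2⟩ : TQ E Q)).2
      (mfderiv 𝓘(ℝ, E) 𝓘(ℝ, E) (extChartAt 𝓘(ℝ, E) x₀.proj).symm y.1 a) =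
      fibreDeriv (inChart L x₀) y a := by
  obtain ⟨b, v⟩ := y
  have hb := mem_target_TQ.1 hy
  let A : E →L[ℝ] E := mfderiv 𝓘(ℝ, E) 𝓘(ℝ, E) (extChartAt 𝓘(ℝ, E) x₀.proj).symm b
  have h1 : HasFDerivAt (fun w : E => inChart L x₀ (b, w))
      ((fderiv ℝ (inChart L x₀) (b, v)).comp (ContinuousLinearMap.inr ℝ E E)) v :=
    ((contDiffAt_inChart hL hy).differentiableAt (by simp)).hasFDerivAt.comp v
      (hasFDerivAt_prodMk_right b v)
  have h2 : HasFDerivAt (fun w : E => inChart L x₀ (b, w))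
      ((fderiv ℝ (fibreRestrict L ((extChartAt 𝓘(ℝ, E) x₀.proj).symm b)) (A v)).comp A) v := by
    have := (differentiableAt_fibreRestrict hL ((extChartAt 𝓘(ℝ, E) x₀.proj).symm b)
      (A v)).hasFDerivAt.comp v A.hasFDerivAt
    refine this.congr_of_eventuallyEq (Filter.Eventually.of_forall fun w => ?_)
    exact fibreRestrict_eq L x₀ hb w
  have h3 := h2.unique h1
  exact congrArg (fun T : E →L[ℝ] ℝ => T a) h3

/-- The coordinate form `(q, v) ↦ (q, ∂L/∂v)`, from which both the smoothness of the Legendre map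
and its derivative are read off. -/
theorem extChartAt_legendre (hL : ContMDiff (modelTQ E) 𝓘(ℝ, ℝ) ∞ L) {x₀ : TQ E Q} {y : E × E}
    (hy : y ∈ (extChartAt (modelTQ E) x₀).target) :
    extChartAt (modelTstarQ E) (legendre L x₀) (legendre L ((extChartAt (modelTQ E) x₀).symm y)) =
      (y.1, fibreDeriv (inChart L x₀) y) := by
  have hy1 := mem_target_TQ.1 hy
  have hs := (extChartAt 𝓘(ℝ, E) x₀.proj).map_target hy1
  rw [extChartAt_source] at hs
  have h := TangentBundle.symmL_trivializationAt (I := 𝓘(ℝ, E)) hs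
  rw [(extChartAt 𝓘(ℝ, E) x₀.proj).right_inv hy1, ModelWithCorners.range_eq_univ,
    mfderivWithin_univ] at h
  rw [extChartAt_symm_TQ hy, FiberBundle.extChartAt]
  refine Prod.ext ?_ ?_
  · exact (extChartAt 𝓘(ℝ, E) x₀.proj).right_inv hy1
  · change (trivializationAt (E →L[ℝ] ℝ) (fun x : Q => CotangentSpace 𝓘(ℝ, E) x) x₀.proj
      (legendre L _)).2 = _
    ext a
    rw [cotangent_trivializationAt_apply, ← legendre_comp_mfderiv hL hy, ← h]
    rfl

end Coordinates

section Coordinates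

variable {E : Type*} [NormedAddCommGroup E] [NormedSpace ℝ E]
  {Q : Type*} [TopologicalSpace Q] [ChartedSpace E Q] [IsManifold 𝓘(ℝ, E) ∞ Q]
  {L : TQ E Q → ℝ}

theorem contMDiff_legendre (hL : ContMDiff (modelTQ E) 𝓘(ℝ, ℝ) ∞ L) :
    ContMDiff (modelTQ E) (modelTstarQ E) ∞ (legendre L) := by
  intro x₀
  rw [contMDiffAt_totalSpace]
  refine ⟨contMDiff_proj (TangentSpace 𝓘(ℝ, E)) x₀, ?_⟩
  have h1 : ContMDiffAt (modelTQ E) 𝓘(ℝ, E →L[ℝ] ℝ) ∞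
      (fun x => fibreDeriv (inChart L x₀) (extChartAt (modelTQ E) x₀ x)) x₀ :=
    (contDiffAt_inChart hL (mem_extChartAt_target x₀)).fibreDeriv.contMDiffAt.comp x₀
      contMDiffAt_extChartAt
  refine h1.congr_of_eventuallyEq ?_
  filter_upwards [extChartAt_source_mem_nhds (I := modelTQ E) x₀] with x hx
  have h := extChartAt_legendre hL ((extChartAt (modelTQ E) x₀).map_source hx)
  rw [(extChartAt (modelTQ E) x₀).left_inv hx] at h
  exact congrArg Prod.snd h

/-- The fibre Hessian and the mixed second derivatives of the Lagrangian at `x`, as the derivative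
of the momenta in the natural coordinates at `x`. -/
def momentumDeriv (L : TQ E Q → ℝ) (x : TQ E Q) : E × E →L[ℝ] E →L[ℝ] ℝ :=
  fderiv ℝ (fibreDeriv (inChart L x)) (extChartAt (modelTQ E) x x)

theorem tangentCoord_mfderiv_legendre (hL : ContMDiff (modelTQ E) 𝓘(ℝ, ℝ) ∞ L) (x : TQ E Q)
    (u : TangentSpace (modelTQ E) x) :
    tangentCoord (modelTstarQ E) _ (mfderiv (modelTQ E) (modelTstarQ E) (legendre L) x u) =
      ((tangentCoord (modelTQ E) x u).1, momentumDeriv L x (tangentCoord (modelTQ E) x u)) := by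
  have hd := (contMDiff_legendre hL).mdifferentiable (by simp) x
  have h1 : HasFDerivAt (fun y : E × E => (y.1, fibreDeriv (inChart L x) y))
      ((ContinuousLinearMap.fst ℝ E E).prod (momentumDeriv L x)) (extChartAt (modelTQ E) x x) :=
    hasFDerivAt_fst.prodMk ((contDiffAt_inChart hL
      (mem_extChartAt_target x)).fibreDeriv.differentiableAt (by simp)).hasFDerivAt
  have h2 : HasFDerivAt (writtenInExtChartAt (modelTQ E) (modelTstarQ E) x (legendre L))
      ((ContinuousLinearMap.fst ℝ E E).prod (momentumDeriv L x)) (extChartAt (modelTQ E) x x) := by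
    refine h1.congr_of_eventuallyEq ?_
    filter_upwards [extChartAt_target_mem_nhds (I := modelTQ E) x] with y hy
    exact extChartAt_legendre hL hy
  rw [hd.mfderiv, ModelWithCorners.range_eq_univ, fderivWithin_univ, h2.fderiv]
  rfl

theorem differential_vertical (hL : ContMDiff (modelTQ E) 𝓘(ℝ, ℝ) ∞ L) (x : TQ E Q) (a : E) :
    differential (modelTQ E) L x ((tangentCoord (modelTQ E) x).symm (0, a)) =
      (legendre L x).2 ((tangentCoord 𝓘(ℝ, E) x.proj).symm a) := by
  have h := (hL.mdifferentiable (by simp)) x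
  have h' := hasMFDerivAt_fibre_coord x
  have h1 := (HasMFDerivAt.comp (tangentCoord 𝓘(ℝ, E) x.proj x.2) h.hasMFDerivAt h').mfderiv
  have h2 := mfderiv_eq_fderiv (𝕜 := ℝ) (f := fibreRestrict L x.proj)
    (x := tangentCoord 𝓘(ℝ, E) x.proj x.2)
  have h3 := h2.symm.trans h1
  exact (congrArg (fun T : E →L[ℝ] ℝ => T a) h3).symm

/-- `Θ_L` is the pull-back of `p_i dq^i` by the Legendre map. This form involves no chart centred at
`x`, so it can be evaluated in the chart at any `x₀`. -/
theorem cartanOneForm_apply (hL : ContMDiff (modelTQ E) 𝓘(ℝ, ℝ) ∞ L) (x : TQ E Q)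
    (u : TangentSpace (modelTQ E) x) :
    cartanOneForm L x u = (legendre L x).2
      (mfderiv (modelTQ E) 𝓘(ℝ, E) (TotalSpace.proj : TQ E Q → Q) x u) := by
  rw [(hasMFDerivAt_proj_coord x).mfderiv]
  exact differential_vertical hL x (tangentCoord (modelTQ E) x u).1

theorem differential_liouville (hL : ContMDiff (modelTQ E) 𝓘(ℝ, ℝ) ∞ L) (x : TQ E Q) :
    differential (modelTQ E) L x (liouville x) = (legendre L x).2 x.2 :=
  differential_vertical hL x _

/-- A version of `legendre_comp_mfderiv` in which the base point is only propositionally equal to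
its coordinate expression; this avoids rewriting inside dependent types. -/
theorem legendre_apply_of_eq (hL : ContMDiff (modelTQ E) 𝓘(ℝ, ℝ) ∞ L) {x₀ : TQ E Q} {y : E × E}
    (hy : y ∈ (extChartAt (modelTQ E) x₀).target) {x : TQ E Q}
    (hx : x = (extChartAt (modelTQ E) x₀).symm y) (a : E) (b : TangentSpace 𝓘(ℝ, E) x.proj)
    (hb : (b : E) = mfderiv 𝓘(ℝ, E) 𝓘(ℝ, E) (extChartAt 𝓘(ℝ, E) x₀.proj).symm y.1 a) :
    (legendre L x).2 b = fibreDeriv (inChart L x₀) y a := by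
  rw [extChartAt_symm_TQ hy] at hx
  subst hx
  rw [← legendre_comp_mfderiv hL hy]
  exact congrArg (legendre L _).2 hb

/-- `Θ_L = (∂L/∂v^i) dq^i`, because in these charts the projection `TQ → Q` is the first coordinate.
-/
theorem oneFormInChart_cartanOneForm (hL : ContMDiff (modelTQ E) 𝓘(ℝ, ℝ) ∞ L) {x₀ : TQ E Q}
    {y : E × E} (hy : y ∈ (extChartAt (modelTQ E) x₀).target) :
    oneFormInChart (modelTQ E) (cartanOneForm L) x₀ y =
      (fibreDeriv (inChart L x₀) y).comp (ContinuousLinearMap.fst ℝ E E) := by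
  refine ContinuousLinearMap.ext fun w => ?_
  refine (cartanOneForm_apply hL _ _).trans ?_
  refine legendre_apply_of_eq hL hy rfl _ _ ?_
  have h1 := mdifferentiableAt_extChartAt_symm_of_mem (modelTQ E) x₀ hy
  have h2 : MDifferentiableAt (modelTQ E) 𝓘(ℝ, E) (TotalSpace.proj : TQ E Q → Q)
    ((extChartAt (modelTQ E) x₀).symm y) := (hasMFDerivAt_proj_coord _).mdifferentiableAt
  have h3 := mfderiv_comp y h2 h1
  have h4 : ((TotalSpace.proj : TQ E Q → Q) ∘ (extChartAt (modelTQ E) x₀).symm) =ᶠ[nhds y]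
      ((extChartAt 𝓘(ℝ, E) x₀.proj).symm ∘ Prod.fst) := by
    filter_upwards [(isOpen_extChartAt_target x₀).mem_nhds hy] with z hz
    rw [Function.comp_apply, extChartAt_symm_TQ hz]
    rfl
  have h5 : MDifferentiableAt 𝓘(ℝ, E × E) 𝓘(ℝ, E) (Prod.fst : E × E → E) y :=
    differentiableAt_fst.mdifferentiableAt
  have h6 := mfderiv_comp y (mdifferentiableAt_extChartAt_symm_of_mem 𝓘(ℝ, E) x₀.proj
    (mem_target_TQ.1 hy)) h5
  have h7 : mfderiv 𝓘(ℝ, E × E) 𝓘(ℝ, E) ((TotalSpace.proj : TQ E Q → Q) ∘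
    (extChartAt (modelTQ E) x₀).symm) y = (_ : E × E →L[ℝ] E) := h4.mfderiv_eq
  have h8 : (mfderiv 𝓘(ℝ, E × E) 𝓘(ℝ, E) (Prod.fst : E × E → E) y : E × E →L[ℝ] E) =
      ContinuousLinearMap.fst ℝ E E := by
    rw [mfderiv_eq_fderiv]
    exact fderiv_fst
  have h9 := h3.symm.trans (h7.trans h6)
  rw [h8] at h9
  exact congrArg (fun T : E × E →L[ℝ] E => T w) h9

theorem inChart_energy (hL : ContMDiff (modelTQ E) 𝓘(ℝ, ℝ) ∞ L) {x₀ : TQ E Q} {y : E × E}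
    (hy : y ∈ (extChartAt (modelTQ E) x₀).target) :
    inChart (energy L) x₀ y = fibreDeriv (inChart L x₀) y y.2 - inChart L x₀ y := by
  rw [inChart, energy, differential_liouville hL, inChart]
  congr 1
  refine legendre_apply_of_eq hL hy rfl _ _ ?_
  rw [extChartAt_symm_TQ hy]

theorem contDiffAt_inChart_energy (hL : ContMDiff (modelTQ E) 𝓘(ℝ, ℝ) ∞ L) {x₀ : TQ E Q}
    {y : E × E} (hy : y ∈ (extChartAt (modelTQ E) x₀).target) :
    ContDiffAt ℝ ∞ (inChart (energy L) x₀) y := by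
  have h := contDiffAt_inChart hL hy
  refine ((h.fibreDeriv.clm_apply contDiffAt_snd).sub h).congr_of_eventuallyEq ?_
  filter_upwards [(isOpen_extChartAt_target x₀).mem_nhds hy] with z hz
  exact inChart_energy hL hz

theorem differential_eq (f : TQ E Q → ℝ) {x₀ x : TQ E Q}
    (hx : x ∈ (extChartAt (modelTQ E) x₀).source)
    (hf : DifferentiableAt ℝ (inChart f x₀) (extChartAt (modelTQ E) x₀ x))
    (u : TangentSpace (modelTQ E) x) :
    differential (modelTQ E) f x u = fderiv ℝ (inChart f x₀) (extChartAt (modelTQ E) x₀ x)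
      (mfderiv (modelTQ E) 𝓘(ℝ, E × E) (extChartAt (modelTQ E) x₀) x u) := by
  have h1 : MDifferentiableAt (modelTQ E) 𝓘(ℝ, E × E) (extChartAt (modelTQ E) x₀) x :=
    (contMDiffAt_extChartAt' (n := ∞) (by rwa [extChartAt_source] at hx)).mdifferentiableAt
      (by simp)
  have h2 := mfderiv_comp x hf.mdifferentiableAt h1
  have h3 : f =ᶠ[nhds x] inChart f x₀ ∘ extChartAt (modelTQ E) x₀ := by
    filter_upwards [(isOpen_extChartAt_source x₀).mem_nhds hx] with z hz
    rw [Function.comp_apply, inChart, (extChartAt (modelTQ E) x₀).left_inv hz]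
  have h4 : (mfderiv (modelTQ E) 𝓘(ℝ, ℝ) f x : E × E →L[ℝ] ℝ) = _ := h3.mfderiv_eq
  have h5 := h4.trans h2
  rw [mfderiv_eq_fderiv] at h5
  exact congrArg (fun T : E × E →L[ℝ] ℝ => T u) h5

/-- The Cartan 2-form in a preferred chart. -/
theorem cartanTwoForm_eq (hL : ContMDiff (modelTQ E) 𝓘(ℝ, ℝ) ∞ L) {x₀ x : TQ E Q}
    (hx : x ∈ (extChartAt (modelTQ E) x₀).source) (u w : TangentSpace (modelTQ E) x) :
    cartanTwoForm L x u w =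
      fderiv ℝ (fibreDeriv (inChart L x₀)) (extChartAt (modelTQ E) x₀ x)
        (mfderiv (modelTQ E) 𝓘(ℝ, E × E) (extChartAt (modelTQ E) x₀) x w)
        (mfderiv (modelTQ E) 𝓘(ℝ, E × E) (extChartAt (modelTQ E) x₀) x u : E × E).1 -
      fderiv ℝ (fibreDeriv (inChart L x₀)) (extChartAt (modelTQ E) x₀ x)
        (mfderiv (modelTQ E) 𝓘(ℝ, E × E) (extChartAt (modelTQ E) x₀) x u)
        (mfderiv (modelTQ E) 𝓘(ℝ, E × E) (extChartAt (modelTQ E) x₀) x w : E × E).1 := by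
  have hy := (extChartAt (modelTQ E) x₀).map_source hx
  have h1 := ((contDiffAt_inChart hL hy).fibreDeriv.differentiableAt (by simp)).hasFDerivAt
  have h2 := h1.clm_comp (hasFDerivAt_const (ContinuousLinearMap.fst ℝ E E) _)
  have h3 := h2.congr_of_eventuallyEq (f₁ := oneFormInChart (modelTQ E) (cartanOneForm L) x₀) (by
    filter_upwards [(isOpen_extChartAt_target x₀).mem_nhds hy] with z hz
    exact oneFormInChart_cartanOneForm hL hz)
  have h4 := extDerivOneForm_eq (modelTQ E) (cartanOneForm L) hx h3.differentiableAt u w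
  change -(extDerivOneForm (modelTQ E) (cartanOneForm L) x u w) = _
  rw [h4, h3.fderiv, neg_sub, ContinuousLinearMap.comp_zero, zero_add]
  rfl

end Coordinates

/-! ### Pointwise formulas: nondegeneracy of `ω_L` and the link with Tulczyjew's map. -/

section Pointwise

variable {E : Type*} [NormedAddCommGroup E] [NormedSpace ℝ E]
  {Q : Type*} [TopologicalSpace Q] [ChartedSpace E Q] [IsManifold 𝓘(ℝ, E) ∞ Q]
  {L : TQ E Q → ℝ}

/-- The chart at `x` has the identity as its differential at its own centre, so the chart
derivatives disappear. -/
theorem cartanTwoForm_apply (hL : ContMDiff (modelTQ E) 𝓘(ℝ, ℝ) ∞ L) (x : TQ E Q)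
    (u w : TangentSpace (modelTQ E) x) :
    cartanTwoForm L x u w =
      momentumDeriv L x (tangentCoord (modelTQ E) x w) (tangentCoord (modelTQ E) x u).1 -
        momentumDeriv L x (tangentCoord (modelTQ E) x u) (tangentCoord (modelTQ E) x w).1 := by
  rw [cartanTwoForm_eq hL (mem_extChartAt_source x), mfderiv_extChartAt_self]
  rfl

theorem extChartAt_self_snd (x : TQ E Q) :
    (extChartAt (modelTQ E) x x).2 = tangentCoord 𝓘(ℝ, E) x.proj x.2 :=
  congrArg Prod.snd (extChartAt_fibre x (tangentCoord 𝓘(ℝ, E) x.proj x.2))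

theorem differential_eq_fderiv (hL : ContMDiff (modelTQ E) 𝓘(ℝ, ℝ) ∞ L) (x : TQ E Q)
    (w : TangentSpace (modelTQ E) x) : differential (modelTQ E) L x w =
      fderiv ℝ (inChart L x) (extChartAt (modelTQ E) x x) (tangentCoord (modelTQ E) x w) := by
  rw [differential_eq L (mem_extChartAt_source x)
    ((contDiffAt_inChart hL (mem_extChartAt_target x)).differentiableAt (by simp)),
    mfderiv_extChartAt_self]
  rfl

/-- Product rule for `E_L = p_i v^i - L`: the three terms are `v^i dp_i`, `p_i dv^i` and `-dL`. -/
theorem differential_energy_apply (hL : ContMDiff (modelTQ E) 𝓘(ℝ, ℝ) ∞ L) (x : TQ E Q)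
    (w : TangentSpace (modelTQ E) x) :
    differential (modelTQ E) (energy L) x w =
      momentumDeriv L x (tangentCoord (modelTQ E) x w) (tangentCoord 𝓘(ℝ, E) x.proj x.2) +
        differential (modelTQ E) L x
          ((tangentCoord (modelTQ E) x).symm (0, (tangentCoord (modelTQ E) x w).2)) -
        differential (modelTQ E) L x w := by
  have hx := mem_extChartAt_target (I := modelTQ E) x
  have h1 := contDiffAt_inChart hL hx
  have h2 : HasFDerivAt (inChart (energy L) x) _ (extChartAt (modelTQ E) x x) :=
    (((h1.fibreDeriv.differentiableAt (by simp)).hasFDerivAt.clm_apply hasFDerivAt_snd).sub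
      (h1.differentiableAt (by simp)).hasFDerivAt).congr_of_eventuallyEq (by
      filter_upwards [(isOpen_extChartAt_target x).mem_nhds hx] with z hz
      exact inChart_energy hL hz)
  rw [differential_eq (energy L) (mem_extChartAt_source x) h2.differentiableAt,
    mfderiv_extChartAt_self, h2.fderiv, differential_eq_fderiv hL, differential_eq_fderiv hL,
    ← extChartAt_self_snd]
  have : ∀ w : E × E, (((fibreDeriv (inChart L x) (extChartAt (modelTQ E) x x)).comp
        (ContinuousLinearMap.snd ℝ E E) +
      (fderiv ℝ (fibreDeriv (inChart L x)) (extChartAt (modelTQ E) x x)).flip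
        (extChartAt (modelTQ E) x x).2) - fderiv ℝ (inChart L x) (extChartAt (modelTQ E) x x)) w =
      momentumDeriv L x w (extChartAt (modelTQ E) x x).2 +
      fderiv ℝ (inChart L x) (extChartAt (modelTQ E) x x) (0, w.2) -
      fderiv ℝ (inChart L x) (extChartAt (modelTQ E) x x) w := by
    intro w
    change (fderiv ℝ (inChart L x) (extChartAt (modelTQ E) x x) (0, w.2) +
      momentumDeriv L x w (extChartAt (modelTQ E) x x).2) - _ = _
    rw [add_comm (momentumDeriv L x w _)]
    rfl
  exact this w

theorem inChart_fibre (L : TQ E Q → ℝ) (x : TQ E Q) (w : E) :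
    inChart L x (extChartAt 𝓘(ℝ, E) x.proj x.proj, w) = fibreRestrict L x.proj w := by
  rw [inChart, ← extChartAt_fibre x w, PartialEquiv.left_inv]
  · rfl
  · rw [mem_source_TQ]
    exact mem_chart_source E x.proj

theorem momentumDeriv_vertical (hL : ContMDiff (modelTQ E) 𝓘(ℝ, ℝ) ∞ L) (x : TQ E Q) (a b : E) :
    momentumDeriv L x (0, a) b = fderiv ℝ (fderiv ℝ (fibreRestrict L x.proj))
      (tangentCoord 𝓘(ℝ, E) x.proj x.2) a b := by
  have hmem : ∀ w : E, (extChartAt 𝓘(ℝ, E) x.proj x.proj, w) ∈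
      (extChartAt (modelTQ E) x).target := fun w =>
    mem_target_TQ.2 (mem_extChartAt_target x.proj)
  have h1 : ∀ w : E, fderiv ℝ (fibreRestrict L x.proj) w =
      fibreDeriv (inChart L x) (extChartAt 𝓘(ℝ, E) x.proj x.proj, w) := fun w => by
    have h := ((contDiffAt_inChart hL (hmem w)).differentiableAt (by simp)).hasFDerivAt.comp w
      (hasFDerivAt_prodMk_right (extChartAt 𝓘(ℝ, E) x.proj x.proj) w)
    exact (h.congr_of_eventuallyEq
      (Filter.Eventually.of_forall fun w => (inChart_fibre L x w).symm)).fderiv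
  have h2 := ((contDiffAt_inChart hL (hmem (tangentCoord 𝓘(ℝ, E) x.proj
    x.2))).fibreDeriv.differentiableAt (by simp)).hasFDerivAt.comp (tangentCoord 𝓘(ℝ, E) x.proj x.2)
      (hasFDerivAt_prodMk_right (extChartAt 𝓘(ℝ, E) x.proj x.proj) _)
  rw [(h2.congr_of_eventuallyEq (Filter.Eventually.of_forall h1)).fderiv]
  have h3 : extChartAt (modelTQ E) x x =
    (extChartAt 𝓘(ℝ, E) x.proj x.proj, tangentCoord 𝓘(ℝ, E) x.proj x.2) :=
    extChartAt_fibre x (tangentCoord 𝓘(ℝ, E) x.proj x.2)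
  rw [momentumDeriv, h3]
  rfl

theorem momentumDeriv_vertical_symm (hL : ContMDiff (modelTQ E) 𝓘(ℝ, ℝ) ∞ L) (x : TQ E Q)
    (a b : E) : momentumDeriv L x (0, a) b = momentumDeriv L x (0, b) a := by
  have hx := mem_extChartAt_target (I := modelTQ E) x
  have h1 := contDiffAt_inChart hL hx
  have hs := h1.isSymmSndFDerivAt (by simpa using two_le_infty)
  have hd : HasFDerivAt (fderiv ℝ (inChart L x)) _ (extChartAt (modelTQ E) x x) :=
    ((h1.fderiv_right (m := 1) two_le_infty).differentiableAt (by simp)).hasFDerivAt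
  have hB := (hd.clm_comp
    (hasFDerivAt_const (ContinuousLinearMap.inr ℝ E E) (extChartAt (modelTQ E) x x))).fderiv
  have h : ∀ a b : E, momentumDeriv L x (0, a) b =
      fderiv ℝ (fderiv ℝ (inChart L x)) (extChartAt (modelTQ E) x x) (0, a) (0, b) := by
    intro a b
    change fderiv ℝ (fun y => (fderiv ℝ (inChart L x) y).comp (ContinuousLinearMap.inr ℝ E E)) _ _ _
      = _
    rw [hB, ContinuousLinearMap.comp_zero, zero_add]
    rfl
  rw [h, h]
  exact hs _ _

theorem eq_zero_of_momentumDeriv_vertical (hL : ContMDiff (modelTQ E) 𝓘(ℝ, ℝ) ∞ L)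
    (hreg : IsRegular L) (x : TQ E Q) {a : E}
    (h : ∀ b, momentumDeriv L x (0, b) a = 0) : a = 0 := by
  refine hreg x.proj (tangentCoord 𝓘(ℝ, E) x.proj x.2) a fun b => ?_
  rw [← momentumDeriv_vertical hL, momentumDeriv_vertical_symm hL, h]

/-- The vertical-vertical block of `ω_L` is zero and the mixed blocks are the fibre Hessian up to
sign. Hence vertical test vectors kill the horizontal component of `u`, and then test vectors `(c,
0)` kill the vertical one. -/
theorem cartanTwoForm_injective (hL : ContMDiff (modelTQ E) 𝓘(ℝ, ℝ) ∞ L)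
    (hreg : IsRegular L) (x : TQ E Q) : Function.Injective (cartanTwoForm L x) := by
  rw [injective_iff_map_eq_zero]
  intro u hu
  have h : ∀ w : E × E, momentumDeriv L x w (tangentCoord (modelTQ E) x u).1 -
        momentumDeriv L x (tangentCoord (modelTQ E) x u) w.1 = 0 := fun w => by
    have := cartanTwoForm_apply hL x u ((tangentCoord (modelTQ E) x).symm w)
    rw [hu] at this
    exact this.symm
  obtain ⟨a, b, rfl⟩ : ∃ a b, u = (tangentCoord (modelTQ E) x).symm (a, b) :=
    ⟨_, _, ((tangentCoord (modelTQ E) x).symm_apply_apply u).symm⟩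
  rw [ContinuousLinearEquiv.apply_symm_apply] at h
  have ha : a = 0 := eq_zero_of_momentumDeriv_vertical hL hreg x fun c => by
    simpa using h (0, c)
  subst ha
  have hb : b = 0 := eq_zero_of_momentumDeriv_vertical hL hreg x fun c => by
    rw [momentumDeriv_vertical_symm hL]
    simpa using h (c, 0)
  rw [hb]
  rfl

theorem legendre_snd_apply (hL : ContMDiff (modelTQ E) 𝓘(ℝ, ℝ) ∞ L) (x : TQ E Q)
    (w : TangentSpace (modelTQ E) x) :
    differential (modelTQ E) L x
          ((tangentCoord (modelTQ E) x).symm (0, (tangentCoord (modelTQ E) x w).2)) =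
    (legendre L x).2 ((tangentCoord 𝓘(ℝ, E) x.proj).symm (tangentCoord (modelTQ E) x w).2) :=
  differential_vertical hL x _

/-- A vector `u` with `i_u ω_L = dE_L + f`, where `f` is horizontal, is of second order. -/
theorem sode_of_cartanTwoForm_eq (hL : ContMDiff (modelTQ E) 𝓘(ℝ, ℝ) ∞ L) (hreg : IsRegular L)
    {x : TQ E Q} {f : CotangentSpace (modelTQ E) x} (hf : f.comp (verticalEndo x) = 0)
    {u : TangentSpace (modelTQ E) x}
    (hu : cartanTwoForm L x u = differential (modelTQ E) (energy L) x + f) :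
    (tangentCoord (modelTQ E) x u).1 = tangentCoord 𝓘(ℝ, E) x.proj x.2 := by
  refine sub_eq_zero.1 (eq_zero_of_momentumDeriv_vertical hL hreg x fun b => ?_)
  -- The vertical vector `(0, b)` is `S(b, 0)`, so a horizontal covector vanishes on it; on such
  -- vectors `dE_L` reduces to the Hessian paired with `v`.
  have hf0 : f ((tangentCoord (modelTQ E) x).symm (0, b)) = 0 :=
    congrArg (fun T : E × E →L[ℝ] ℝ => T (b, 0)) hf
  have h1 := congrArg (fun T : CotangentSpace (modelTQ E) x =>
    T ((tangentCoord (modelTQ E) x).symm (0, b))) hu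
  have h2 := h1.trans (add_apply _ _ _)
  rw [hf0, cartanTwoForm_apply hL, differential_energy_apply hL] at h2
  simp only [ContinuousLinearEquiv.apply_symm_apply, map_zero, sub_zero, add_zero,
    add_sub_cancel_right] at h2
  rw [map_sub, h2, sub_self]

/-- The Euler–Lagrange equations with force, `ṗ_i dq^i + p_i dv^i = dL - f`; the left side is the
covector that Tulczyjew's map attaches to `T F_L(u)`. -/
theorem momentumDeriv_of_cartanTwoForm_eq (hL : ContMDiff (modelTQ E) 𝓘(ℝ, ℝ) ∞ L)
    {x : TQ E Q} {f : CotangentSpace (modelTQ E) x}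
    {u : TangentSpace (modelTQ E) x}
    (hu1 : (tangentCoord (modelTQ E) x u).1 = tangentCoord 𝓘(ℝ, E) x.proj x.2)
    (hu : cartanTwoForm L x u = differential (modelTQ E) (energy L) x + f)
    (w : TangentSpace (modelTQ E) x) :
    momentumDeriv L x (tangentCoord (modelTQ E) x u) (tangentCoord (modelTQ E) x w).1 +
      (legendre L x).2 ((tangentCoord 𝓘(ℝ, E) x.proj).symm (tangentCoord (modelTQ E) x w).2) =
      differential (modelTQ E) L x w - f w := by
  have h1 := congrArg (fun T : CotangentSpace (modelTQ E) x => T w) hu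
  have h2 := h1.trans (add_apply _ _ _)
  rw [cartanTwoForm_apply hL, differential_energy_apply hL, hu1, legendre_snd_apply hL] at h2
  linarith

theorem tulczyjew_tangentMap_legendre (hL : ContMDiff (modelTQ E) 𝓘(ℝ, ℝ) ∞ L)
    (hreg : IsRegular L) {x : TQ E Q} {f : CotangentSpace (modelTQ E) x}
    (hf : f.comp (verticalEndo x) = 0) {u : TangentSpace (modelTQ E) x}
    (hu : cartanTwoForm L x u = differential (modelTQ E) (energy L) x + f) :
    tulczyjew (tangentMap (modelTQ E) (modelTstarQ E) (legendre L) ⟨x, u⟩) =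
      (⟨x, differential (modelTQ E) L x - f⟩ : TstarTQ E Q) := by
  have h1 := sode_of_cartanTwoForm_eq hL hreg hf hu
  have h2 := momentumDeriv_of_cartanTwoForm_eq hL h1 hu
  have h3 := tangentCoord_mfderiv_legendre hL x u
  rw [h1] at h3
  -- The base point of `tulczyjew` depends on the velocity coordinate, so the coordinate pair is
  -- generalized to `c` and then substituted as a whole.
  have key : ∀ c : E × (E →L[ℝ] ℝ),
      c = (tangentCoord 𝓘(ℝ, E) x.proj x.2,
        momentumDeriv L x (tangentCoord (modelTQ E) x u)) →
      tulczyjew (⟨legendre L x, (tangentCoord (modelTstarQ E) _).symm c⟩ : TTstarQ E Q) =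
        (⟨x, differential (modelTQ E) L x - f⟩ : TstarTQ E Q) := by
    rintro _ rfl
    refine congrArg (TotalSpace.mk x) (ContinuousLinearMap.ext fun w => ?_)
    exact h2 w
  exact key _ h3

theorem tulczyjew_injective : Function.Injective (tulczyjew : TTstarQ E Q → TstarTQ E Q) := by
  rintro ⟨⟨q, p⟩, c⟩ ⟨⟨q', p'⟩, c'⟩ h
  obtain ⟨h1, h2⟩ := TotalSpace.mk.inj h
  obtain ⟨rfl, h3⟩ := TotalSpace.mk.inj h1
  obtain ⟨a, b⟩ : E × (E →L[ℝ] ℝ) := c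
  obtain ⟨a', b'⟩ : E × (E →L[ℝ] ℝ) := c'
  have h3' : a = a' := eq_of_heq h3
  subst h3'
  have h4 : b.coprod (p : E →L[ℝ] ℝ) = b'.coprod (p' : E →L[ℝ] ℝ) := eq_of_heq h2
  have hb : b = b' := by
    ext e
    have h5 : b e + p 0 = b' e + p' 0 := congrArg (fun T : E × E →L[ℝ] ℝ => T (e, 0)) h4
    simpa using h5
  have hp : (p : E →L[ℝ] ℝ) = p' := by
    ext e
    have h5 : b 0 + (p : E →L[ℝ] ℝ) e = b' 0 + (p' : E →L[ℝ] ℝ) e :=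
      congrArg (fun T : E × E →L[ℝ] ℝ => T (0, e)) h4
    simpa using h5
  subst hb
  have hp' : p = p' := hp
  subst hp'
  rfl

end Pointwise

/-! ### Transversality as a direct sum decomposition. -/

section LinearAlgebra

/-- If no nonzero covector annihilates both `D` and `σ(F)`, and `rank F = corank D`, then `σ(F)` is
a complement of `D`. -/
theorem isCompl_map_of_transversal {V : Type*} [AddCommGroup V] [Module ℝ V] [TopologicalSpace V]
    [IsTopologicalAddGroup V] [ContinuousSMul ℝ V] [T2Space V] [FiniteDimensional ℝ V]
    (D : Submodule ℝ V) (F : Submodule ℝ (V →L[ℝ] ℝ)) (σ : (V →L[ℝ] ℝ) →ₗ[ℝ] V)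
    (hσ : Function.Injective σ) (hrank : Module.finrank ℝ F = Module.finrank ℝ (V ⧸ D))
    (h : ∀ a : V →L[ℝ] ℝ, (∀ w ∈ D, a w = 0) → (∀ g ∈ F, a (σ g) = 0) → a = 0) :
    IsCompl D (F.map σ) := by
  have hsup : D ⊔ F.map σ = ⊤ := by
    by_contra hne
    -- A proper subspace lies in the kernel of a nonzero functional, which the hypothesis `h`
    -- excludes; the trivial intersection then follows by counting dimensions.
    obtain ⟨a, ha, hle⟩ := Submodule.exists_le_ker_of_lt_top _ (lt_top_iff_ne_top.2 hne)
    apply ha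
    have h0 : a.toContinuousLinearMap = 0 := by
      refine h _ (fun w hw => ?_) fun g hg => ?_
      · exact hle (Submodule.mem_sup_left hw)
      · exact hle (Submodule.mem_sup_right (Submodule.mem_map_of_mem hg))
    ext w
    exact congrArg (fun T : V →L[ℝ] ℝ => T w) h0
  refine ⟨disjoint_iff.2 ?_, codisjoint_iff.2 hsup⟩
  have h1 := Submodule.finrank_sup_add_finrank_inf_eq D (F.map σ)
  have h2 := (Submodule.equivMapOfInjective σ hσ F).finrank_eq
  have h3 := D.finrank_quotient_add_finrank
  rw [hsup, finrank_top, ← h2, hrank] at h1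
  exact Submodule.finrank_eq_zero.1 (by omega)

end LinearAlgebra

/-! ### The equation `E ∩ D̂` as the graph of a field, and compatibility. -/

section Pointwise

variable {E : Type*} [NormedAddCommGroup E] [NormedSpace ℝ E]
  {Q : Type*} [TopologicalSpace Q] [ChartedSpace E Q] [IsManifold 𝓘(ℝ, E) ∞ Q]
  {L : TQ E Q → ℝ}

/-- The derivative is block triangular, with the identity and the fibre Hessian on the diagonal. -/
theorem tangentMap_legendre_injective (hL : ContMDiff (modelTQ E) 𝓘(ℝ, ℝ) ∞ L) (hreg : IsRegular L)
    (x : TQ E Q) : Function.Injective (mfderiv (modelTQ E) (modelTstarQ E) (legendre L) x) := by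
  let T : E × E →L[ℝ] E × (E →L[ℝ] ℝ) := mfderiv (modelTQ E) (modelTstarQ E) (legendre L) x
  change Function.Injective T
  rw [injective_iff_map_eq_zero]
  rintro ⟨a, b⟩ hu
  have h : T (a, b) = (a, momentumDeriv L x (a, b)) := tangentCoord_mfderiv_legendre hL x _
  rw [hu] at h
  have ha : a = 0 := (congrArg Prod.fst h).symm
  subst ha
  have hb : b = 0 := eq_zero_of_momentumDeriv_vertical hL hreg x fun c => by
    rw [momentumDeriv_vertical_symm hL]
    exact (congrArg (fun T : E × (E →L[ℝ] ℝ) => T.2 c) h).symm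
  rw [hb]
  rfl

instance [FiniteDimensional ℝ E] (x : TQ E Q) : FiniteDimensional ℝ (TangentSpace (modelTQ E) x) :=
  inferInstanceAs (FiniteDimensional ℝ (E × E))

instance (x : TQ E Q) : T2Space (TangentSpace (modelTQ E) x) := inferInstanceAs (T2Space (E × E))

namespace Problem

variable (P : Problem E Q)

/-- The image `Λ_L(F_x)` of the reaction forces at `x`. -/
def forceDirections (x : TQ E Q) : Submodule ℝ (TangentSpace (modelTQ E) x) :=
  (P.F x).map
    (poissonSharp P.L x : CotangentSpace (modelTQ E) x →ₗ[ℝ] TangentSpace (modelTQ E) x)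

theorem exists_permitted_modification {x : TQ E Q}
    (h : IsCompl (P.D x) (P.forceDirections x)) :
    ∃ u ∈ P.D x, ∃ f ∈ P.F x, u = eulerLagrangeField P.L x + poissonSharp P.L x f := by
  have : eulerLagrangeField P.L x ∈ P.D x ⊔ P.forceDirections x := by
    rw [h.sup_eq_top]
    trivial
  obtain ⟨u, hu, w, ⟨f, hf, rfl⟩, huw⟩ := Submodule.mem_sup.1 this
  -- The decomposition is `Γ_L = u + Λ_L(f)`, hence the force that corrects `Γ_L` to `u` is `-f`.
  refine ⟨u, hu, -f, neg_mem hf, ?_⟩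
  rw [← huw, map_neg]
  exact (add_neg_cancel_right _ _).symm

theorem eq_of_permitted_modification {x : TQ E Q}
    (h : IsCompl (P.D x) (P.forceDirections x))
    {u u' : TangentSpace (modelTQ E) x} (hu : u ∈ P.D x) (hu' : u' ∈ P.D x)
    (hf : ∃ f ∈ P.F x, u = eulerLagrangeField P.L x + poissonSharp P.L x f)
    (hf' : ∃ f ∈ P.F x, u' = eulerLagrangeField P.L x + poissonSharp P.L x f) : u = u' := by
  obtain ⟨f, hf, e⟩ := hf
  obtain ⟨f', hf', e'⟩ := hf'
  refine sub_eq_zero.1 (Submodule.disjoint_def.1 h.disjoint _ (sub_mem hu hu')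
    ⟨f - f', sub_mem hf hf', ?_⟩)
  rw [e, e', add_sub_add_left_eq_sub]
  exact map_sub _ _ _

theorem tangentLegendre_injective (x : TQ E Q) {u u' : TangentSpace (modelTQ E) x}
    (h : P.tangentLegendre ⟨x, u⟩ = P.tangentLegendre ⟨x, u'⟩) : u = u' :=
  tangentMap_legendre_injective P.smooth_L P.regular_L x (eq_of_heq (TotalSpace.mk.inj h).2)

/-- An element of `D̂` over `F_L(x)` comes from `D_x`, for each `x ∈ C`. -/
theorem mem_D_of_mem_Dhat (hD : P.DhatWellDefined) {x : TQ E Q} (hx : x ∈ P.C)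
    {u : TangentSpace (modelTQ E) x} (h : P.tangentLegendre ⟨x, u⟩ ∈ P.Dhat) : u ∈ P.D x := by
  obtain ⟨⟨y, w⟩, ⟨hy, hw⟩, hyw⟩ := h
  have h1 : legendre P.L y = legendre P.L x := congrArg TotalSpace.proj hyw
  have h2 : P.tangentLegendre ⟨x, u⟩ ∈ P.tangentLegendre '' P.fibreD x := by
    rw [← hD y hy x hx h1, ← hyw]
    exact mem_image_of_mem _ ⟨w, hw, rfl⟩
  obtain ⟨-, ⟨u', hu', rfl⟩, h3⟩ := h2
  rwa [← P.tangentLegendre_injective x h3]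

end Problem

variable [FiniteDimensional ℝ E]

theorem cartanTwoForm_isInvertible (hL : ContMDiff (modelTQ E) 𝓘(ℝ, ℝ) ∞ L) (hreg : IsRegular L)
    (x : TQ E Q) : (cartanTwoForm L x).IsInvertible := by
  have hinj := cartanTwoForm_injective hL hreg x
  have hfr : Module.finrank ℝ (E × E) = Module.finrank ℝ (E × E →L[ℝ] ℝ) := by
    rw [← (LinearMap.toContinuousLinearMap (𝕜 := ℝ) (E := E × E) (F' := ℝ)).finrank_eq]
    exact (Subspace.dual_finrank_eq (K := ℝ) (V := E × E)).symm
  let T : E × E →L[ℝ] (E × E →L[ℝ] ℝ) := cartanTwoForm L x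
  let e : (E × E) ≃L[ℝ] (E × E →L[ℝ] ℝ) :=
    (LinearEquiv.ofInjectiveOfFinrankEq (T : E × E →ₗ[ℝ] _) hinj hfr).toContinuousLinearEquiv
  refine ⟨e, ?_⟩
  ext u
  rfl

theorem cartanTwoForm_poissonSharp (hL : ContMDiff (modelTQ E) 𝓘(ℝ, ℝ) ∞ L) (hreg : IsRegular L)
    (x : TQ E Q) (a : CotangentSpace (modelTQ E) x) :
    cartanTwoForm L x (poissonSharp L x a) = a :=
  (cartanTwoForm_isInvertible hL hreg x).self_apply_inverse a

theorem poissonSharp_cartanTwoForm (hL : ContMDiff (modelTQ E) 𝓘(ℝ, ℝ) ∞ L) (hreg : IsRegular L)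
    (x : TQ E Q) (u : TangentSpace (modelTQ E) x) :
    poissonSharp L x (cartanTwoForm L x u) = u :=
  (cartanTwoForm_isInvertible hL hreg x).inverse_apply_self u

/-- Applying the invertible map `u ↦ i_u ω_L` replaces statements about `Λ_L` by linear equations
without inverses. -/
theorem eq_eulerLagrangeField_add_iff (hL : ContMDiff (modelTQ E) 𝓘(ℝ, ℝ) ∞ L) (hreg : IsRegular L)
    (x : TQ E Q) (u : TangentSpace (modelTQ E) x) (f : CotangentSpace (modelTQ E) x) :
    u = eulerLagrangeField L x + poissonSharp L x f ↔
      cartanTwoForm L x u = differential (modelTQ E) (energy L) x + f := by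
  rw [eulerLagrangeField, ← map_add]
  constructor
  · rintro rfl
    rw [cartanTwoForm_poissonSharp hL hreg]
  · intro h
    rw [← h, poissonSharp_cartanTwoForm hL hreg]

namespace Problem

variable (P : Problem E Q)

theorem isCompl_map_poissonSharp {x : TQ E Q}
    (hrank : Module.finrank ℝ (P.F x) =
      Module.finrank ℝ (TangentSpace (modelTQ E) x ⧸ P.D x))
    (htrans : annihilator (modelTQ E) (P.D x) ⊓ poissonOrthogonal P.L (P.F x) = ⊥) :
    IsCompl (P.D x) (P.forceDirections x) := by
  refine isCompl_map_of_transversal _ _ _ ?_ hrank fun a h1 h2 => ?_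
  · exact Function.LeftInverse.injective (g := cartanTwoForm P.L x)
      (cartanTwoForm_poissonSharp P.smooth_L P.regular_L x)
  · have : a ∈ annihilator (modelTQ E) (P.D x) ⊓ poissonOrthogonal P.L (P.F x) := by
      refine ⟨h1, fun g hg => ?_⟩
      -- `Λ_L(a, g) = a(Λ_L(g))`: Poisson orthogonality to `F` is vanishing on `Λ_L(F)`.
      rw [poissonTensor, cartanTwoForm_poissonSharp P.smooth_L P.regular_L]
      exact h2 g hg
    rw [htrans] at this
    exact this

theorem tulczyjew_tangentLegendre {x : TQ E Q} (hx : x ∈ P.C)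
    {f : CotangentSpace (modelTQ E) x} (hf : f ∈ P.F x) :
    tulczyjew (P.tangentLegendre ⟨x, eulerLagrangeField P.L x + poissonSharp P.L x f⟩) =
      (⟨x, differential (modelTQ E) P.L x - f⟩ : TstarTQ E Q) :=
  tulczyjew_tangentMap_legendre P.smooth_L P.regular_L (P.F_horizontal x hx f hf)
    ((eq_eulerLagrangeField_add_iff P.smooth_L P.regular_L x _ f).1 rfl)

theorem mem_equation_iff (z : TTstarQ E Q) : z ∈ P.equation ↔ ∃ x ∈ P.C, ∃ f ∈ P.F x,
    z = P.tangentLegendre ⟨x, eulerLagrangeField P.L x + poissonSharp P.L x f⟩ := by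
  constructor
  · rintro ⟨hx, f, hf, h⟩
    -- The base point is that of `α(z)`, and the sign compensates `α(T F_L(Γ_L + Λ_L(f))) = dL - f`.
    refine ⟨_, hx, -f, neg_mem hf, tulczyjew_injective ?_⟩
    rw [P.tulczyjew_tangentLegendre hx (neg_mem hf), sub_neg_eq_add, ← h]
  · rintro ⟨x, hx, f, hf, rfl⟩
    rw [equation, mem_preimage, P.tulczyjew_tangentLegendre hx hf]
    exact ⟨hx, -f, neg_mem hf, sub_eq_add_neg _ _⟩

theorem Cstar_eq : P.Cstar = legendre P.L '' P.C := by
  ext p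
  constructor
  · rintro ⟨z, hz, rfl⟩
    obtain ⟨x, hx, f, hf, rfl⟩ := (P.mem_equation_iff z).1 hz
    exact ⟨x, hx, rfl⟩
  · rintro ⟨x, hx, rfl⟩
    exact ⟨_, (P.mem_equation_iff _).2 ⟨x, hx, 0, zero_mem _, rfl⟩, rfl⟩

variable {P} {Γ : ∀ x : TQ E Q, TangentSpace (modelTQ E) x}

theorem tangentLegendre_mem (hF : P.IsReactionModification Γ) (hD : P.IsPermitted Γ) {x : TQ E Q}
    (hx : x ∈ P.C) : P.tangentLegendre ⟨x, Γ x⟩ ∈ P.equation ∩ P.Dhat := by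
  obtain ⟨f, hf, h⟩ := hF x hx
  refine ⟨(P.mem_equation_iff _).2 ⟨x, hx, f, hf, by rw [h]⟩, mem_image_of_mem _ ⟨hx, hD x hx⟩⟩

/-- Membership in `E` fixes a point `x`, whereas membership in `D̂` may come from another point with
the same Legendre image; `hwd` moves it to `x`, where the intersection with `D` is a single vector.
-/
theorem legendreGraph_eq (hwd : P.DhatWellDefined)
    (hcompl : ∀ x ∈ P.C, IsCompl (P.D x) (P.forceDirections x))
    (hF : P.IsReactionModification Γ) (hD : P.IsPermitted Γ) :
    P.legendreGraph Γ = P.equation ∩ P.Dhat := by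
  ext z
  constructor
  · rintro ⟨x, hx, rfl⟩
    exact tangentLegendre_mem hF hD hx
  · rintro ⟨hz, hz'⟩
    obtain ⟨x, hx, f, hf, rfl⟩ := (P.mem_equation_iff z).1 hz
    refine ⟨x, hx, ?_⟩
    rw [P.eq_of_permitted_modification (hcompl x hx) (P.mem_D_of_mem_Dhat hwd hx hz') (hD x hx)
      ⟨f, hf, rfl⟩ (hF x hx)]

theorem isSODE (hF : P.IsReactionModification Γ) : P.IsSODE Γ := by
  intro x hx
  obtain ⟨f, hf, h⟩ := hF x hx
  have h1 := sode_of_cartanTwoForm_eq P.smooth_L P.regular_L (P.F_horizontal x hx f hf)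
    ((eq_eulerLagrangeField_add_iff P.smooth_L P.regular_L x _ f).1 h)
  exact congrArg (fun a : E => (tangentCoord (modelTQ E) x).symm (0, a)) h1

/-- The Legendre map need not be injective on `C`, so membership in `E` a priori only gives a
representative at some `y`. The base point of `α(z)` is `(q, q̇)`: it is `x` by the second-order
condition and `y` by the representation, so `x = y`. -/
theorem isReactionModification_of_isSODE {Γ' : ∀ x : TQ E Q, TangentSpace (modelTQ E) x}
    (hS : P.IsSODE Γ') {x : TQ E Q} (hx : x ∈ P.C)
    (h : P.tangentLegendre ⟨x, Γ' x⟩ ∈ P.equation) :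
    ∃ f ∈ P.F x, Γ' x = eulerLagrangeField P.L x + poissonSharp P.L x f := by
  obtain ⟨y, hy, f, hf, hyf⟩ := (P.mem_equation_iff _).1 h
  have h1 := congrArg (fun η : TstarTQ E Q => η.proj) ((congrArg tulczyjew hyf).trans
    (P.tulczyjew_tangentLegendre hy hf))
  have h2 : (tulczyjew (P.tangentLegendre ⟨x, Γ' x⟩)).proj = x := by
    have h3 := congrArg Prod.fst (tangentCoord_mfderiv_legendre P.smooth_L x (Γ' x))
    have h4 : (tangentCoord (modelTQ E) x (Γ' x)).1 = tangentCoord 𝓘(ℝ, E) x.proj x.2 :=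
      congrArg (fun a : E × E => a.2) (hS x hx)
    exact congrArg (TotalSpace.mk' E x.proj) (h3.trans h4)
  have h5 : x = y := h2.symm.trans h1
  subst h5
  exact ⟨f, hf, P.tangentLegendre_injective x hyf⟩

theorem compatible (hF : P.IsReactionModification Γ) (hD : P.IsPermitted Γ) : P.Compatible := by
  have hC : TotalSpace.proj '' (P.equation ∩ P.Dhat) = P.Cstar := by
    refine Subset.antisymm (image_mono inter_subset_left) ?_
    rw [P.Cstar_eq]
    rintro _ ⟨x, hx, rfl⟩
    exact ⟨_, tangentLegendre_mem hF hD hx, rfl⟩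
  -- Each vector of `D` is the velocity of a curve in `C`; its Legendre image is a curve in `C^*`
  -- with the transported velocity.
  have hDhat : {z ∈ P.Dhat | z.proj ∈ P.Cstar} ∩ tangentSet (modelTstarQ E) P.Cstar = P.Dhat := by
    refine Subset.antisymm (fun z hz => hz.1.1) ?_
    rintro _ ⟨⟨x, w⟩, ⟨hx, hw⟩, rfl⟩
    refine ⟨⟨mem_image_of_mem _ ⟨hx, hw⟩, ?_⟩, ?_⟩
    · rw [P.Cstar_eq]
      exact ⟨x, hx, rfl⟩
    · obtain ⟨γ, hγ, hγC, h⟩ := P.D_tangent x hx w hw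
      have hl := contMDiff_legendre P.smooth_L
      refine ⟨legendre P.L ∘ γ, hl.comp hγ, fun t => ?_, ?_⟩
      · rw [P.Cstar_eq]
        exact ⟨_, hγC t, rfl⟩
      · rw [tangentMap_comp_at _ (hl.mdifferentiable (by simp) _)
          (hγ.mdifferentiable (by simp) _), h]
        rfl
  intro k hk
  induction k, hk using Nat.le_induction with
  | base =>
    simp only [algorithm]
    rw [hC, hDhat]
  | succ k _ ih =>
    rw [algorithm, ih]
    simp only [inter_assoc, inter_self]
    rw [hC, hDhat]

end Problem

end Pointwise

/-! ### Smoothness of the field: frames and linear systems. -/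

section Coefficients

/-- The coefficients of a smooth map with respect to a smooth moving frame are smooth. -/
theorem contMDiffWithinAt_frame_coeff {F : Type*} [NormedAddCommGroup F] [NormedSpace ℝ F]
    {H : Type*} [TopologicalSpace H] {I : ModelWithCorners ℝ F H} {M : Type*} [TopologicalSpace M]
    [ChartedSpace H M] {W : Type*} [NormedAddCommGroup W] [NormedSpace ℝ W]
    {ι : Type*} [Fintype ι] {S : Set M} {x₀ : M} (hx₀ : x₀ ∈ S) {c : ι → M → W} {r : M → W}
    {a : M → ι → ℝ} (hc : ∀ i, ContMDiffWithinAt I 𝓘(ℝ, W) ∞ (c i) S x₀)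
    (hr : ContMDiffWithinAt I 𝓘(ℝ, W) ∞ r S x₀) (hli : LinearIndependent ℝ (fun i => c i x₀))
    (hsp : ⊤ ≤ Submodule.span ℝ (Set.range fun i => c i x₀))
    (ha : ∀ᶠ x in nhdsWithin x₀ S, ∑ i, a x i • c i x = r x) :
    ContMDiffWithinAt I 𝓘(ℝ, ι → ℝ) ∞ a S x₀ := by
  -- `T x` sends coefficients to the combination of the frame. It is invertible at `x₀`, hence
  -- nearby, and inversion of operators is smooth, so `a = T⁻¹ r` is smooth.
  let T : M → (ι → ℝ) →L[ℝ] W := fun x =>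
    ∑ i, ContinuousLinearMap.smulRightL ℝ (ι → ℝ) W (ContinuousLinearMap.proj i) (c i x)
  have hT : ContMDiffWithinAt I 𝓘(ℝ, (ι → ℝ) →L[ℝ] W) ∞ T S x₀ :=
    contMDiffWithinAt_finsetSum fun i _ =>
      (ContinuousLinearMap.contDiff _).contDiffAt.comp_contMDiffWithinAt (hc i)
  have hTa : ∀ x (b : ι → ℝ), T x b = ∑ i, b i • c i x := fun x b => by
    simp [T]
  let b := Module.Basis.mk hli hsp
  have : FiniteDimensional ℝ W := b.finiteDimensional_of_finite
  let e : (ι → ℝ) ≃L[ℝ] W := b.equivFun.symm.toContinuousLinearEquiv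
  have he : (e : (ι → ℝ) →L[ℝ] W) = T x₀ := by
    ext1 v
    rw [hTa]
    simp [e, b, Module.Basis.equivFun_symm_apply]
  have hinv : ContMDiffWithinAt I 𝓘(ℝ, W →L[ℝ] ι → ℝ) ∞ (fun x => (T x).inverse) S x₀ := by
    have h1 := contDiffAt_map_inverse (𝕜 := ℝ) (n := ∞) e
    rw [he] at h1
    exact h1.comp_contMDiffWithinAt hT
  have hev : ∀ᶠ x in nhdsWithin x₀ S, (T x).IsInvertible := by
    have h1 : ∀ᶠ A in nhds (T x₀), A.IsInvertible := by
      rw [← he]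
      exact ContinuousLinearEquiv.nhds e
    exact hT.continuousWithinAt h1
  have h : ∀ᶠ x in nhdsWithin x₀ S, a x = (T x).inverse (r x) := by
    filter_upwards [hev, ha] with x hx hxa
    rw [← hxa, ← hTa, hx.inverse_apply_self]
  exact (hinv.clm_apply hr).congr_of_eventuallyEq h (h.self_of_nhdsWithin hx₀)

theorem linearIndependent_and_span_sumElim {V W ι κ : Type*} [AddCommGroup V] [Module ℝ V]
    [AddCommGroup W] [Module ℝ W] {D : Submodule ℝ V} {F : Submodule ℝ W} (σ : W →ₗ[ℝ] V)
    (hσ : Function.Injective σ) (hc : IsCompl D (F.map σ)) {s : ι → V} {t : κ → W}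
    (hs : LinearIndependent ℝ s) (hsD : Submodule.span ℝ (Set.range s) = D)
    (ht : LinearIndependent ℝ t) (htF : Submodule.span ℝ (Set.range t) = F) :
    LinearIndependent ℝ (Sum.elim s (fun j => σ (t j))) ∧
      Submodule.span ℝ (Set.range (Sum.elim s (fun j => σ (t j)))) = ⊤ := by
  have hspan : Submodule.span ℝ (Set.range fun j => σ (t j)) = F.map σ := by
    rw [← htF, Submodule.map_span, ← Set.range_comp]
    rfl
  constructor
  · refine LinearIndependent.sum_type hs (ht.map' σ (LinearMap.ker_eq_bot.2 hσ)) ?_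
    rw [hsD, hspan]
    exact hc.disjoint
  · rw [Set.Sum.elim_range, Submodule.span_union, hsD, hspan]
    exact hc.sup_eq_top

theorem linearIndependent_and_span_map {V W ι : Type*} [AddCommGroup V] [Module ℝ V]
    [AddCommGroup W] [Module ℝ W] {b : ι → V} (T : V →ₗ[ℝ] W) (hT : Function.Bijective T)
    (hli : LinearIndependent ℝ b) (hsp : Submodule.span ℝ (Set.range b) = ⊤) :
    LinearIndependent ℝ (T ∘ b) ∧ Submodule.span ℝ (Set.range (T ∘ b)) = ⊤ := by
  refine ⟨hli.map' T (LinearMap.ker_eq_bot.2 hT.1), ?_⟩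
  rw [Set.range_comp, ← Submodule.map_span, hsp, Submodule.map_top, LinearMap.range_eq_top]
  exact hT.2

end Coefficients

set_option synthInstance.maxHeartbeats 400000 in
theorem _root_.ContMDiffWithinAt.clm_flip {F : Type*} [NormedAddCommGroup F] [NormedSpace ℝ F]
    {H : Type*} [TopologicalSpace H] {I : ModelWithCorners ℝ F H} {M : Type*} [TopologicalSpace M]
    [ChartedSpace H M] {U V W : Type*} [NormedAddCommGroup U] [NormedSpace ℝ U]
    [NormedAddCommGroup V] [NormedSpace ℝ V] [NormedAddCommGroup W] [NormedSpace ℝ W]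
    {S : Set M} {x₀ : M} {B : M → U →L[ℝ] V →L[ℝ] W}
    (hB : ContMDiffWithinAt I 𝓘(ℝ, U →L[ℝ] V →L[ℝ] W) ∞ B S x₀) :
    ContMDiffWithinAt I 𝓘(ℝ, V →L[ℝ] U →L[ℝ] W) ∞ (fun x => (B x).flip) S x₀ := by
  have h : ContDiff ℝ ∞ (ContinuousLinearMap.flip : (U →L[ℝ] V →L[ℝ] W) → V →L[ℝ] U →L[ℝ] W) := by
    exact ContinuousLinearEquiv.contDiff (𝕜 := ℝ) (E := U →L[ℝ] V →L[ℝ] W)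
      (F := V →L[ℝ] U →L[ℝ] W) (ContinuousLinearMap.flipₗᵢ ℝ U V W).toContinuousLinearEquiv
  exact h.contDiffAt.comp_contMDiffWithinAt hB

section Smoothness

variable {E : Type*} [NormedAddCommGroup E] [NormedSpace ℝ E]
  {Q : Type*} [TopologicalSpace Q] [ChartedSpace E Q] [IsManifold 𝓘(ℝ, E) ∞ Q]
  {L : TQ E Q → ℝ}

/-- The covector `i_u ω_L` in the preferred chart at `x₀`. -/
def chartTwoForm (L : TQ E Q → ℝ) (x₀ : TQ E Q) (y u : E × E) : E × E →L[ℝ] ℝ :=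
  (fderiv ℝ (fibreDeriv (inChart L x₀)) y).flip u.1 -
    (fderiv ℝ (fibreDeriv (inChart L x₀)) y u).comp (ContinuousLinearMap.fst ℝ E E)

theorem contMDiffWithinAt_chartTwoForm (hL : ContMDiff (modelTQ E) 𝓘(ℝ, ℝ) ∞ L) {x₀ : TQ E Q}
    {S : Set (TQ E Q)} {σ : TQ E Q → E × E}
    (hσ : ContMDiffWithinAt (modelTQ E) 𝓘(ℝ, E × E) ∞ σ S x₀) :
    ContMDiffWithinAt (modelTQ E) 𝓘(ℝ, E × E →L[ℝ] ℝ) ∞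
      (fun x => chartTwoForm L x₀ (extChartAt (modelTQ E) x₀ x) (σ x)) S x₀ := by
  have hB : ContMDiffWithinAt (modelTQ E) 𝓘(ℝ, E × E →L[ℝ] E →L[ℝ] ℝ) ∞
      (fun x => fderiv ℝ (fibreDeriv (inChart L x₀)) (extChartAt (modelTQ E) x₀ x)) S x₀ :=
    ((contDiffAt_inChart hL (mem_extChartAt_target x₀)).fibreDeriv.fderiv_right (m := ∞)
      (by simp)).comp_contMDiffWithinAt contMDiffAt_extChartAt.contMDiffWithinAt
  have h1 := (hB.clm_flip).clm_apply
    ((ContinuousLinearMap.fst ℝ E E).contDiff.contDiffAt.comp_contMDiffWithinAt hσ)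
  exact h1.sub ((hB.clm_apply hσ).clm_comp contMDiffWithinAt_const)

theorem mfderiv_extChartAt_symmL {x₀ x : TQ E Q} (hx : x ∈ (extChartAt (modelTQ E) x₀).source)
    (w : E × E) : mfderiv (modelTQ E) 𝓘(ℝ, E × E) (extChartAt (modelTQ E) x₀) x
      ((trivializationAt (E × E) (TangentSpace (modelTQ E)) x₀).symmL ℝ x w) = w := by
  rw [extChartAt_source] at hx
  rw [← TangentBundle.continuousLinearMapAt_trivializationAt hx]
  exact Trivialization.continuousLinearMapAt_symmL _ hx w

theorem trivializationAt_snd_eq_mfderiv {x₀ x : TQ E Q}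
    (hx : x ∈ (extChartAt (modelTQ E) x₀).source) (u : TangentSpace (modelTQ E) x) :
    (trivializationAt (E × E) (TangentSpace (modelTQ E)) x₀ (⟨x, u⟩ : TTQ E Q)).2 =
      mfderiv (modelTQ E) 𝓘(ℝ, E × E) (extChartAt (modelTQ E) x₀) x u := by
  rw [extChartAt_source] at hx
  rw [← TangentBundle.continuousLinearMapAt_trivializationAt hx]
  exact (Trivialization.continuousLinearMapAt_apply_of_mem ℝ _ hx u).symm

theorem cartanTwoForm_symmL (hL : ContMDiff (modelTQ E) 𝓘(ℝ, ℝ) ∞ L) {x₀ x : TQ E Q}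
    (hx : x ∈ (extChartAt (modelTQ E) x₀).source) (u : TangentSpace (modelTQ E) x) (w : E × E) :
    cartanTwoForm L x u ((trivializationAt (E × E) (TangentSpace (modelTQ E)) x₀).symmL ℝ x w) =
      chartTwoForm L x₀ (extChartAt (modelTQ E) x₀ x)
        (trivializationAt (E × E) (TangentSpace (modelTQ E)) x₀ (⟨x, u⟩ : TTQ E Q)).2 w := by
  rw [cartanTwoForm_eq hL hx, mfderiv_extChartAt_symmL hx, trivializationAt_snd_eq_mfderiv hx]
  rfl

theorem differential_energy_symmL (hL : ContMDiff (modelTQ E) 𝓘(ℝ, ℝ) ∞ L) {x₀ x : TQ E Q}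
    (hx : x ∈ (extChartAt (modelTQ E) x₀).source) (w : E × E) :
    differential (modelTQ E) (energy L) x
        ((trivializationAt (E × E) (TangentSpace (modelTQ E)) x₀).symmL ℝ x w) =
      fderiv ℝ (inChart (energy L) x₀) (extChartAt (modelTQ E) x₀ x) w := by
  rw [differential_eq _ hx ((contDiffAt_inChart_energy hL
    ((extChartAt (modelTQ E) x₀).map_source hx)).differentiableAt (by simp)),
    mfderiv_extChartAt_symmL hx]

/-- With `u = Σ a_i s_i` and `-f = Σ a'_j t_j`, the equation `i_u ω_L - f = dE_L` becomes a linear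
system for `(a, a')` in a fixed vector space. The force is expanded with its sign reversed so that
all unknowns stand on one side. -/
theorem frame_equation (hL : ContMDiff (modelTQ E) 𝓘(ℝ, ℝ) ∞ L) {x₀ x : TQ E Q}
    (hx : x ∈ (extChartAt (modelTQ E) x₀).source) {ι κ : Type*} [Fintype ι] [Fintype κ]
    {s : ι → TangentSpace (modelTQ E) x} {t : κ → CotangentSpace (modelTQ E) x}
    {a : ι → ℝ} {a' : κ → ℝ} {u : TangentSpace (modelTQ E) x} {f : CotangentSpace (modelTQ E) x}
    (hu : ∑ i, a i • s i = u) (hf : ∑ j, a' j • t j = -f)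
    (h : cartanTwoForm L x u = differential (modelTQ E) (energy L) x + f) :
    ∑ i, Sum.elim a a' i • Sum.elim
        (fun i => chartTwoForm L x₀ (extChartAt (modelTQ E) x₀ x)
          (trivializationAt (E × E) (TangentSpace (modelTQ E)) x₀ (⟨x, s i⟩ : TTQ E Q)).2)
        (fun j => (trivializationAt (E × E →L[ℝ] ℝ)
          (fun x : TQ E Q => CotangentSpace (modelTQ E) x) x₀ (⟨x, t j⟩ : TstarTQ E Q)).2) i =
      fderiv ℝ (inChart (energy L) x₀) (extChartAt (modelTQ E) x₀ x) := by
  refine ContinuousLinearMap.ext fun w => ?_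
  rw [← differential_energy_symmL hL hx, Fintype.sum_sum_type]
  simp only [Sum.elim_inl, Sum.elim_inr]
  generalize hw : (trivializationAt (E × E) (TangentSpace (modelTQ E)) x₀).symmL ℝ x w = w'
  have h1 : ∀ i, chartTwoForm L x₀ (extChartAt (modelTQ E) x₀ x)
          (trivializationAt (E × E) (TangentSpace (modelTQ E)) x₀ (⟨x, s i⟩ : TTQ E Q)).2 w =
      cartanTwoForm L x (s i) w' := fun i => by
    rw [← hw, cartanTwoForm_symmL hL hx]
  have h2 : ∀ j, (trivializationAt (E × E →L[ℝ] ℝ)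
          (fun x : TQ E Q => CotangentSpace (modelTQ E) x) x₀ (⟨x, t j⟩ : TstarTQ E Q)).2 w =
      t j w' := fun j => by
    rw [← hw]
    exact cotangent_trivializationAt_apply (I := modelTQ E) x₀ (⟨x, t j⟩ : TstarTQ E Q) w
  have h3 : (cartanTwoForm L x u - f) w' = differential (modelTQ E) (energy L) x w' := by
    rw [h, add_sub_cancel_right]
  rw [← h3, sub_eq_add_neg, ← hf, ← hu, map_sum, add_apply, add_apply, sum_apply, sum_apply,
    sum_apply, sum_apply]
  simp only [map_smul, smul_apply, h1, h2]

theorem symmL_trivializationAt_self (x : TQ E Q) (w : E × E) :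
    (trivializationAt (E × E) (TangentSpace (modelTQ E)) x).symmL ℝ x w =
      (tangentCoord (modelTQ E) x).symm w := by
  have h := mfderiv_extChartAt_symmL (mem_extChartAt_source (I := modelTQ E) x) w
  rw [mfderiv_extChartAt_self] at h
  exact h

variable [FiniteDimensional ℝ E]

namespace Problem

variable {P : Problem E Q} {Γ : ∀ x : TQ E Q, TangentSpace (modelTQ E) x}

theorem isSmoothAlong (hcompl : ∀ x ∈ P.C, IsCompl (P.D x) (P.forceDirections x))
    (hF : P.IsReactionModification Γ) (hD : P.IsPermitted Γ) : P.IsSmoothAlong Γ := by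
  intro x₀ hx₀
  obtain ⟨U, hU, hxU, k, s, hs, hsD⟩ := P.subbundle_D x₀ hx₀
  obtain ⟨U', hU', hxU', m, t, ht, htF⟩ := P.subbundle_F x₀ hx₀
  let σ : Fin k → TQ E Q → E × E := fun i x =>
    (trivializationAt (E × E) (TangentSpace (modelTQ E)) x₀ (⟨x, s i x⟩ : TTQ E Q)).2
  let τ : Fin m → TQ E Q → (E × E →L[ℝ] ℝ) := fun j x =>
    (trivializationAt (E × E →L[ℝ] ℝ) (fun x : TQ E Q => CotangentSpace (modelTQ E) x) x₀
      (⟨x, t j x⟩ : TstarTQ E Q)).2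
  have hσ : ∀ i, ContMDiffWithinAt (modelTQ E) 𝓘(ℝ, E × E) ∞ (σ i) P.C x₀ := fun i => by
    have h := contMDiffWithinAt_section.1 (hs i x₀ ⟨hxU, hx₀⟩)
    rwa [inter_comm, contMDiffWithinAt_inter (hU.mem_nhds hxU)] at h
  have hτ : ∀ j, ContMDiffWithinAt (modelTQ E) 𝓘(ℝ, E × E →L[ℝ] ℝ) ∞ (τ j) P.C x₀ := fun j => by
    have h := contMDiffWithinAt_section.1 (ht j x₀ ⟨hxU', hx₀⟩)
    rwa [inter_comm, contMDiffWithinAt_inter (hU'.mem_nhds hxU')] at h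
  let c : Fin k ⊕ Fin m → TQ E Q → (E × E →L[ℝ] ℝ) := Sum.elim
    (fun i x => chartTwoForm P.L x₀ (extChartAt (modelTQ E) x₀ x) (σ i x)) τ
  have hc : ∀ i, ContMDiffWithinAt (modelTQ E) 𝓘(ℝ, E × E →L[ℝ] ℝ) ∞ (c i) P.C x₀ := by
    rintro (i | j)
    · exact contMDiffWithinAt_chartTwoForm P.smooth_L (hσ i)
    · exact hτ j
  have hr : ContMDiffWithinAt (modelTQ E) 𝓘(ℝ, E × E →L[ℝ] ℝ) ∞
      (fun x => fderiv ℝ (inChart (energy P.L) x₀) (extChartAt (modelTQ E) x₀ x)) P.C x₀ :=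
    ((contDiffAt_inChart_energy P.smooth_L (mem_extChartAt_target x₀)).fderiv_right (m := ∞)
      (by simp)).comp_contMDiffWithinAt contMDiffAt_extChartAt.contMDiffWithinAt
  let b : Fin k ⊕ Fin m → E × E :=
    Sum.elim (fun i => s i x₀) (fun j => poissonSharp P.L x₀ (t j x₀))
  let T : E × E →L[ℝ] E × E →L[ℝ] ℝ := cartanTwoForm P.L x₀
  -- At `x₀` the columns of the system are the images under `ω_L` of the `s_i` and `Λ_L(t_j)`, a
  -- basis by the decomposition `D ⊕ Λ_L(F)`.
  have hcω : (fun i => c i x₀) = T ∘ b := by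
    funext i
    refine ContinuousLinearMap.ext fun w => ?_
    rcases i with i | j
    · have h := cartanTwoForm_symmL P.smooth_L (mem_extChartAt_source (I := modelTQ E) x₀)
        (s i x₀) w
      rw [symmL_trivializationAt_self] at h
      exact h.symm
    · have h := cotangent_trivializationAt_apply (I := modelTQ E) x₀ (⟨x₀, t j x₀⟩ : TstarTQ E Q) w
      rw [symmL_trivializationAt_self] at h
      have h' := cartanTwoForm_poissonSharp P.smooth_L P.regular_L x₀ (t j x₀)
      exact h.trans (congrArg (fun T : E × E →L[ℝ] ℝ => T w) h'.symm)
  have hsD₀ := hsD x₀ ⟨hxU, hx₀⟩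
  have htF₀ := htF x₀ ⟨hxU', hx₀⟩
  have hinj : Function.Injective (poissonSharp P.L x₀) :=
    Function.LeftInverse.injective (g := cartanTwoForm P.L x₀)
      (cartanTwoForm_poissonSharp P.smooth_L P.regular_L x₀)
  have hb := linearIndependent_and_span_sumElim
    (poissonSharp P.L x₀ : CotangentSpace (modelTQ E) x₀ →ₗ[ℝ] TangentSpace (modelTQ E) x₀) hinj
    (hcompl x₀ hx₀) hsD₀.1 hsD₀.2 htF₀.1 htF₀.2
  have hTinj : Function.Injective T := cartanTwoForm_injective P.smooth_L P.regular_L x₀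
  have hTsurj : Function.Surjective T := Function.RightInverse.surjective (g := poissonSharp P.L x₀)
        (cartanTwoForm_poissonSharp P.smooth_L P.regular_L x₀)
  have hcb := linearIndependent_and_span_map (b := b) (T : E × E →ₗ[ℝ] E × E →L[ℝ] ℝ)
    ⟨hTinj, hTsurj⟩ hb.1 hb.2
  have hcli : LinearIndependent ℝ (fun i => c i x₀) := by
    rw [hcω]
    exact hcb.1
  have hcsp : ⊤ ≤ Submodule.span ℝ (Set.range fun i => c i x₀) := by
    rw [hcω]
    exact hcb.2.ge
  -- The coefficients are chosen pointwise, with 0 as default away from the common domain; their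
  -- smoothness is forced by the linear system.
  have hcoeff : ∀ x : TQ E Q, ∃ a : Fin k ⊕ Fin m → ℝ,
      x ∈ P.C → x ∈ U → x ∈ U' → x ∈ (extChartAt (modelTQ E) x₀).source →
      (∑ i, a (Sum.inl i) • s i x = Γ x ∧ ∑ i, a i • c i x =
        fderiv ℝ (inChart (energy P.L) x₀) (extChartAt (modelTQ E) x₀ x)) := by
    intro x
    by_cases hx : x ∈ P.C ∧ x ∈ U ∧ x ∈ U' ∧ x ∈ (extChartAt (modelTQ E) x₀).source
    · obtain ⟨hxC, hxU, hxU', hxs⟩ := hx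
      obtain ⟨f, hf, hΓ⟩ := hF x hxC
      have hD' := hD x hxC
      rw [← (hsD x ⟨hxU, hxC⟩).2] at hD'
      have hf' := neg_mem hf
      rw [← (htF x ⟨hxU', hxC⟩).2] at hf'
      obtain ⟨a, ha⟩ := (Submodule.mem_span_range_iff_exists_fun ℝ).1 hD'
      obtain ⟨a', ha'⟩ := (Submodule.mem_span_range_iff_exists_fun ℝ).1 hf'
      refine ⟨Sum.elim a a', fun _ _ _ _ => ⟨ha, ?_⟩⟩
      have heq := frame_equation P.smooth_L hxs ha ha'
        ((eq_eulerLagrangeField_add_iff P.smooth_L P.regular_L x _ f).1 hΓ)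
      refine Eq.trans (Finset.sum_congr rfl fun i _ => ?_) heq
      rcases i with i | j <;> rfl
    · exact ⟨0, fun h1 h2 h3 h4 => absurd ⟨h1, h2, h3, h4⟩ hx⟩
  choose a ha using hcoeff
  have hnhds : ∀ᶠ x in nhdsWithin x₀ P.C, x ∈ P.C ∧ x ∈ U ∧ x ∈ U' ∧
      x ∈ (extChartAt (modelTQ E) x₀).source := by
    filter_upwards [self_mem_nhdsWithin, mem_nhdsWithin_of_mem_nhds (hU.mem_nhds hxU),
      mem_nhdsWithin_of_mem_nhds (hU'.mem_nhds hxU'),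
      mem_nhdsWithin_of_mem_nhds (extChartAt_source_mem_nhds (I := modelTQ E) x₀)]
      with x h1 h2 h3 h4
    exact ⟨h1, h2, h3, h4⟩
  have hasm := contMDiffWithinAt_frame_coeff hx₀ hc hr hcli hcsp (a := a)
    (hnhds.mono fun x hx => (ha x hx.1 hx.2.1 hx.2.2.1 hx.2.2.2).2)
  have hG : ContMDiffWithinAt (modelTQ E) 𝓘(ℝ, E × E) ∞
      (fun x => ∑ i, a x (Sum.inl i) • σ i x) P.C x₀ := by
    refine contMDiffWithinAt_finsetSum fun i _ => ?_
    have hai : ContMDiffWithinAt (modelTQ E) 𝓘(ℝ, ℝ) ∞ (fun x => a x (Sum.inl i)) P.C x₀ :=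
      contMDiffWithinAt_pi_space.1 hasm (Sum.inl i)
    exact hai.smul (hσ i)
  have hev : ∀ᶠ x in nhdsWithin x₀ P.C,
      (trivializationAt (E × E) (TangentSpace (modelTQ E)) x₀ (⟨x, Γ x⟩ : TTQ E Q)).2 =
        ∑ i, a x (Sum.inl i) • σ i x := by
    filter_upwards [hnhds] with x hx
    rw [← (ha x hx.1 hx.2.1 hx.2.2.1 hx.2.2.2).1, trivializationAt_snd_eq_mfderiv hx.2.2.2, map_sum]
    refine Finset.sum_congr rfl fun i _ => ?_
    rw [map_smul]
    exact congrArg (a x (Sum.inl i) • ·) (trivializationAt_snd_eq_mfderiv hx.2.2.2 _).symm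
  exact contMDiffWithinAt_section.2 (hG.congr_of_eventuallyEq hev (hev.self_of_nhdsWithin hx₀))


end Problem

end Smoothness

/-! ### Integral curves on embedded submanifolds. -/

section IntegralCurves

/-- Solutions of a smooth autonomous differential equation exist and are smooth. -/
theorem exists_smooth_solution {K : Type*} [NormedAddCommGroup K] [NormedSpace ℝ K]
    [CompleteSpace K] {V : K → K} {W : Set K} (hW : IsOpen W) (hV : ContDiffOn ℝ ∞ V W) {k₀ : K}
    (hk₀ : k₀ ∈ W) : ∃ ε > (0 : ℝ), ∃ α : ℝ → K, α 0 = k₀ ∧ ContDiffOn ℝ ∞ α (Ioo (-ε) ε) ∧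
      ∀ t ∈ Ioo (-ε) ε, α t ∈ W ∧ HasDerivAt α (V (α t)) t := by
  have h1 : ContDiffAt ℝ 1 V k₀ := (hV.contDiffAt (hW.mem_nhds hk₀)).of_le one_le_infty
  obtain ⟨α, h0, ε, hε, hα⟩ :=
    h1.exists_forall_mem_closedBall_exists_eq_forall_mem_Ioo_hasDerivAt₀ 0
  rw [zero_sub, zero_add] at hα
  have hc : ∀ᶠ t in nhds (0 : ℝ), α t ∈ W := by
    have := (hα 0 ⟨neg_lt_zero.2 hε, hε⟩).continuousAt
    exact this.eventually (by rw [h0]; exact hW.mem_nhds hk₀)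
  obtain ⟨δ, hδ, hball⟩ := Metric.eventually_nhds_iff.1 hc
  have hsub : ∀ t ∈ Ioo (-(min ε δ)) (min ε δ), α t ∈ W ∧ HasDerivAt α (V (α t)) t := by
    intro t ht
    have ht' := abs_lt.2 ht
    refine ⟨hball ?_, hα t (abs_lt.1 (ht'.trans_le (min_le_left _ _)))⟩
    rw [Real.dist_eq, sub_zero]
    exact ht'.trans_le (min_le_right _ _)
  -- Bootstrap: if `α` is `C^n`, so is `α' = V ∘ α`, hence `α` is `C^{n+1}`.
  refine ⟨min ε δ, lt_min hε hδ, α, h0, contDiffOn_infty.2 fun n => ?_, hsub⟩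
  induction n with
  | zero =>
    exact contDiffOn_zero.2 fun t ht => (hsub t ht).2.continuousAt.continuousWithinAt
  | succ n ih =>
    have h2 : ContDiffOn ℝ n (deriv α) (Ioo (-(min ε δ)) (min ε δ)) := by
      have h3 : ContDiffOn ℝ n (V ∘ α) (Ioo (-(min ε δ)) (min ε δ)) :=
        (contDiffOn_infty.1 hV n).comp ih fun t ht => (hsub t ht).1
      exact h3.congr fun t ht => (hsub t ht).2.deriv
    have h4 := (contDiffOn_succ_iff_deriv_of_isOpen (𝕜 := ℝ) (n := (n : ℕ∞ω)) (f := α)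
      (isOpen_Ioo (a := -(min ε δ)) (b := min ε δ))).2
      ⟨fun t ht => (hsub t ht).2.differentiableAt.differentiableWithinAt, by simp, h2⟩
    exact_mod_cast h4

theorem exists_continuousProjection {F : Type*} [NormedAddCommGroup F] [NormedSpace ℝ F]
    [FiniteDimensional ℝ F] (K : Submodule ℝ F) :
    ∃ p : F →L[ℝ] K, ∀ k : F, (p k : F) = k ↔ k ∈ K := by
  obtain ⟨p, hp⟩ := K.subtype.exists_leftInverse_of_injective K.ker_subtype
  refine ⟨⟨p, p.continuous_of_finiteDimensional⟩, fun k => ⟨fun h => h ▸ (p k).2, fun h => ?_⟩⟩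
  exact congrArg Subtype.val (congrArg (fun T : K →ₗ[ℝ] K => T ⟨k, h⟩) hp)

/-- Differentiate `p ∘ f - f = 0`, where `p` is a projection onto `K`. -/
theorem mem_of_hasDerivAt {F : Type*} [NormedAddCommGroup F] [NormedSpace ℝ F]
    [FiniteDimensional ℝ F] {K : Submodule ℝ F} {f : ℝ → F} {f' : F} {t : ℝ}
    (hf : HasDerivAt f f' t) (h : ∀ᶠ s in nhds t, f s ∈ K) : f' ∈ K := by
  obtain ⟨p, hp⟩ := exists_continuousProjection K
  have h1 := ((K.subtypeL.comp p).hasFDerivAt.comp_hasDerivAt t hf).sub hf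
  have h2 : (fun s => (p (f s) : F) - f s) =ᶠ[nhds t] fun _ => 0 := h.mono fun s hs => by
    exact sub_eq_zero.2 ((hp _).2 hs)
  exact (hp f').1 (sub_eq_zero.1
    (h1.unique ((hasDerivAt_const t 0).congr_of_eventuallyEq h2)))

variable {F : Type*} [NormedAddCommGroup F] [NormedSpace ℝ F]
    {H : Type*} [TopologicalSpace H] {I : ModelWithCorners ℝ F H} {M : Type*}
    [TopologicalSpace M] [ChartedSpace H M]

theorem contMDiffOn_extend_of_mem {φ : OpenPartialHomeomorph M H}
    (hφ : φ ∈ IsManifold.maximalAtlas I ∞ M) :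
    ContMDiffOn I 𝓘(ℝ, F) ∞ (φ.extend I) φ.source :=
  (I.contMDiff (n := ∞)).comp_contMDiffOn (contMDiffOn_of_mem_maximalAtlas hφ)

theorem contMDiffOn_extend_symm_target {φ : OpenPartialHomeomorph M H}
    (hφ : φ ∈ IsManifold.maximalAtlas I ∞ M) :
    ContMDiffOn 𝓘(ℝ, F) I ∞ (φ.extend I).symm (φ.extend I).target := by
  rw [OpenPartialHomeomorph.extend_target']
  exact contMDiffOn_extend_symm hφ

variable [I.Boundaryless]

theorem mfderiv_extend_injective {φ : OpenPartialHomeomorph M H}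
    (hφ : φ ∈ IsManifold.maximalAtlas I ∞ M) {m : M} (hm : m ∈ φ.source) :
    Function.Injective (mfderiv I 𝓘(ℝ, F) (φ.extend I) m) := by
  have hm' : m ∈ (φ.extend I).source := by rwa [OpenPartialHomeomorph.extend_source]
  have h1 : MDifferentiableAt I 𝓘(ℝ, F) (φ.extend I) m :=
    ((contMDiffOn_extend_of_mem hφ).contMDiffAt (φ.open_source.mem_nhds hm)).mdifferentiableAt
      (by simp)
  have h2 : MDifferentiableAt 𝓘(ℝ, F) I (φ.extend I).symm (φ.extend I m) :=
    ((contMDiffOn_extend_symm_target hφ).contMDiffAt (φ.isOpen_extend_target.mem_nhds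
      ((φ.extend I).map_source hm'))).mdifferentiableAt (by simp)
  have h3 := mfderiv_comp m h2 h1
  have h4 : (φ.extend I).symm ∘ φ.extend I =ᶠ[nhds m] id := by
    filter_upwards [φ.extend_source_mem_nhds (I := I) hm] with z hz
    exact (φ.extend I).left_inv hz
  have h5 : (mfderiv I I ((φ.extend I).symm ∘ φ.extend I) m : F →L[ℝ] F) =
    ContinuousLinearMap.id ℝ F := h4.mfderiv_eq.trans mfderiv_id
  rw [h3] at h5
  exact Function.LeftInverse.injective
    (g := mfderiv 𝓘(ℝ, F) I (φ.extend I).symm (φ.extend I m)) fun u =>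
      congrArg (fun T : F →L[ℝ] F => T u) h5

variable [IsManifold I ∞ M]

/-- A smooth vector field on an embedded submanifold has smooth integral curves. -/
theorem exists_integralCurve_of_tangent [FiniteDimensional ℝ F] {S : Set M}
    (hS : IsEmbeddedSubmanifold I S) {X : ∀ m : M, TangentSpace I m}
    (hX : ContMDiffOn I (I.prod 𝓘(ℝ, F)) ∞ (fun m => (⟨m, X m⟩ : TangentBundle I M)) S)
    (htan : ∀ m ∈ S, (⟨m, X m⟩ : TangentBundle I M) ∈ tangentSet I S) {m₀ : M} (hm₀ : m₀ ∈ S) :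
    ∃ ε > (0 : ℝ), ∃ γ : ℝ → M, γ 0 = m₀ ∧ ContMDiffOn 𝓘(ℝ, ℝ) I ∞ γ (Ioo (-ε) ε) ∧
      ∀ t ∈ Ioo (-ε) ε, γ t ∈ S ∧
        tangentMap 𝓘(ℝ, ℝ) I γ ⟨t, (tangentCoord 𝓘(ℝ, ℝ) t).symm 1⟩ = ⟨γ t, X (γ t)⟩ := by
  obtain ⟨φ, hφ, hmφ, K, hK⟩ := hS m₀ hm₀
  have hψ := contMDiffOn_extend_of_mem hφ
  have hψs := contMDiffOn_extend_symm_target hφ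
  have hψd : ∀ m ∈ φ.source, MDifferentiableAt I 𝓘(ℝ, F) (φ.extend I) m := fun m hm =>
    (hψ.contMDiffAt (φ.open_source.mem_nhds hm)).mdifferentiableAt (by simp)
  let G : M → F := fun m => mfderiv I 𝓘(ℝ, F) (φ.extend I) m (X m)
  have hG : ContMDiffOn I 𝓘(ℝ, F) ∞ G (S ∩ φ.source) := by
    have h1 := (hψ.contMDiffOn_tangentMapWithin (m := ∞) (by simp)
      φ.open_source.uniqueMDiffOn).comp (hX.mono inter_subset_left)
      (fun m (hm : m ∈ S ∩ φ.source) => hm.2)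
    have h2 := (contMDiff_snd_tangentBundle_modelSpace (n := ∞) F 𝓘(ℝ, F)).comp_contMDiffOn h1
    refine h2.congr fun m hm => ?_
    exact congrArg (fun T : F →L[ℝ] F => T (X m))
      (mfderivWithin_of_isOpen φ.open_source hm.2).symm
  -- `X m` is the velocity of a curve in `S`, and the slice chart maps that curve into `K`.
  have hGK : ∀ m ∈ S ∩ φ.source, G m ∈ K := by
    rintro m ⟨hmS, hm⟩
    obtain ⟨c, hc, hcS, hcm⟩ := htan m hmS
    have hc0 : c 0 = m := congrArg TotalSpace.proj hcm
    have hcφ : c 0 ∈ φ.source := by rwa [hc0]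
    have hcd : MDifferentiableAt 𝓘(ℝ, ℝ) I c 0 := hc.mdifferentiable (by simp) 0
    have h1 := tangentMap_comp_at (⟨0, (tangentCoord 𝓘(ℝ, ℝ) 0).symm 1⟩ : TangentBundle 𝓘(ℝ, ℝ) ℝ)
      (hψd (c 0) hcφ) hcd
    rw [hcm] at h1
    have h2 : fderiv ℝ (φ.extend I ∘ c) 0 1 = G m := by
      rw [← mfderiv_eq_fderiv]
      exact congrArg (fun z : TangentBundle 𝓘(ℝ, F) F => (z.2 : F)) h1
    have h3 : DifferentiableAt ℝ (φ.extend I ∘ c) 0 :=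
      ((hψd (c 0) hcφ).comp 0 hcd).differentiableAt
    rw [← h2]
    refine mem_of_hasDerivAt h3.hasDerivAt ?_
    filter_upwards [hc.continuous.continuousAt (φ.open_source.mem_nhds hcφ)] with s hs
    exact (hK (c s) hs).1 (hcS s)
  obtain ⟨p, hp⟩ := exists_continuousProjection K
  let ι : K → M := fun k => (φ.extend I).symm k
  let W : Set K := {k | (k : F) ∈ (φ.extend I).target}
  have hW : IsOpen W := φ.isOpen_extend_target.preimage continuous_subtype_val
  have hιsource : ∀ k ∈ W, ι k ∈ φ.source := fun k hk => by
    have := (φ.extend I).map_target hk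
    rwa [OpenPartialHomeomorph.extend_source] at this
  have hιS : ∀ k ∈ W, ι k ∈ S ∩ φ.source := fun k hk => by
    refine ⟨(hK _ (hιsource k hk)).2 ?_, hιsource k hk⟩
    have : φ.extend I (ι k) = k := (φ.extend I).right_inv hk
    rw [OpenPartialHomeomorph.extend_coe, Function.comp_apply] at this
    rw [this]
    exact k.2
  have hι : ContMDiffOn 𝓘(ℝ, K) I ∞ ι W :=
    hψs.comp K.subtypeL.contDiff.contMDiff.contMDiffOn fun k hk => hk
  -- The ODE is solved inside the slice `K`, which keeps the solution in `S`. The projection only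
  -- retypes `G` as a `K`-valued map, since `G` already takes values in `K`.
  have hV : ContDiffOn ℝ ∞ (fun k => p (G (ι k))) W :=
    (p.contDiff.contMDiff.comp_contMDiffOn (hG.comp hι hιS)).contDiffOn
  have hm₀' : m₀ ∈ (φ.extend I).source := by rwa [OpenPartialHomeomorph.extend_source]
  have hk₀ : φ.extend I m₀ ∈ K := (hK m₀ hmφ).1 hm₀
  obtain ⟨ε, hε, α, hα0, hα, hαt⟩ := exists_smooth_solution hW hV
    (k₀ := ⟨φ.extend I m₀, hk₀⟩) ((φ.extend I).map_source hm₀')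
  have hγ : ContMDiffOn 𝓘(ℝ, ℝ) I ∞ (ι ∘ α) (Ioo (-ε) ε) :=
    hι.comp hα.contMDiffOn fun t ht => (hαt t ht).1
  refine ⟨ε, hε, ι ∘ α, ?_, hγ, fun t ht => ⟨(hιS _ (hαt t ht).1).1, ?_⟩⟩
  · rw [Function.comp_apply, hα0]
    exact (φ.extend I).left_inv hm₀'
  have hγd : MDifferentiableAt 𝓘(ℝ, ℝ) I (ι ∘ α) t :=
    (hγ.contMDiffAt (Ioo_mem_nhds ht.1 ht.2)).mdifferentiableAt (by simp)
  have hmem := hιS _ (hαt t ht).1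
  -- The chart has injective differential, so the velocity is compared with `X` after applying it.
  refine congrArg (TotalSpace.mk ((ι ∘ α) t)) (mfderiv_extend_injective hφ hmem.2 ?_)
  have h1 := mfderiv_comp t (hψd _ hmem.2) hγd
  rw [mfderiv_eq_fderiv] at h1
  have h2 : HasDerivAt (φ.extend I ∘ ι ∘ α) (p (G (ι (α t))) : F) t := by
    refine (K.subtypeL.hasFDerivAt.comp_hasDerivAt t (hαt t ht).2).congr_of_eventuallyEq ?_
    filter_upwards [Ioo_mem_nhds ht.1 ht.2] with s hs
    exact (φ.extend I).right_inv (hαt s hs).1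
  have h3 : fderiv ℝ (φ.extend I ∘ ι ∘ α) t 1 = (p (G (ι (α t))) : F) := h2.deriv
  have h4 : (p (G (ι (α t))) : F) = G (ι (α t)) :=
    (hp _).2 (hGK _ hmem)
  exact (congrArg (fun T : ℝ →L[ℝ] F => T 1) h1).symm.trans (h3.trans h4)

end IntegralCurves

/-! ### Transport of integral curves to the cotangent bundle, and the main theorem. -/

section Integrability

variable {E : Type*} [NormedAddCommGroup E] [NormedSpace ℝ E] [FiniteDimensional ℝ E]
  {Q : Type*} [TopologicalSpace Q] [ChartedSpace E Q] [IsManifold 𝓘(ℝ, E) ∞ Q]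

theorem Problem.isIntegrableEquation_legendreGraph {P : Problem E Q}
    {Γ : ∀ x : TQ E Q, TangentSpace (modelTQ E) x} (hΓ : P.IsSmoothAlong Γ)
    (hD : P.IsPermitted Γ) : IsIntegrableEquation (modelTstarQ E) (P.legendreGraph Γ) := by
  rintro _ ⟨x, hx, rfl⟩
  obtain ⟨ε, hε, γ, hγ0, hγ, hγt⟩ := exists_integralCurve_of_tangent P.submanifold_C hΓ
    (fun m hm => P.D_tangent m hm _ (hD m hm)) hx
  have hl := contMDiff_legendre P.smooth_L
  have key : ∀ t ∈ Ioo (-ε) ε, tangentMap 𝓘(ℝ, ℝ) (modelTstarQ E) (legendre P.L ∘ γ)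
      ⟨t, (tangentCoord 𝓘(ℝ, ℝ) t).symm 1⟩ = P.tangentLegendre ⟨γ t, Γ (γ t)⟩ := fun t ht => by
    rw [tangentMap_comp_at _ (hl.mdifferentiable (by simp) _)
      ((hγ.contMDiffAt (Ioo_mem_nhds ht.1 ht.2)).mdifferentiableAt (by simp)), (hγt t ht).2]
    rfl
  refine ⟨ε, hε, legendre P.L ∘ γ, hl.comp_contMDiffOn hγ, fun t ht => ?_, ?_⟩
  · rw [key t ht]
    exact ⟨γ t, (hγt t ht).1, rfl⟩
  · rw [key 0 ⟨neg_lt_zero.2 hε, hε⟩, hγ0]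

end Integrability

end NonHolonomic

end

theorem mainTheorem1 {E : Type*} [NormedAddCommGroup E] [NormedSpace ℝ E] [FiniteDimensional ℝ E]
    {Q : Type*} [TopologicalSpace Q] [ChartedSpace E Q] [IsManifold 𝓘(ℝ, E) ∞ Q]
    (P : NonHolonomic.Problem E Q)
    (hDhat : P.DhatWellDefined)
    (hrank : ∀ x ∈ P.C, Module.finrank ℝ (P.F x) =
      Module.finrank ℝ (TangentSpace (NonHolonomic.modelTQ E) x ⧸ P.D x))
    (htrans : ∀ x ∈ P.C, NonHolonomic.annihilator (NonHolonomic.modelTQ E) (P.D x) ⊓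
      NonHolonomic.poissonOrthogonal P.L (P.F x) = ⊥) :
    P.Compatible ∧ P.Cstar = NonHolonomic.legendre P.L '' P.C ∧
    NonHolonomic.IsIntegrableEquation (NonHolonomic.modelTstarQ E) (P.equation ∩ P.Dhat) ∧
    ∃ Γ : ∀ x : NonHolonomic.TQ E Q, TangentSpace (NonHolonomic.modelTQ E) x,
      P.IsSmoothAlong Γ ∧ P.IsSODE Γ ∧ P.IsReactionModification Γ ∧ P.IsPermitted Γ ∧
      P.legendreGraph Γ = P.equation ∩ P.Dhat ∧
      (∀ Γ' : ∀ x : NonHolonomic.TQ E Q, TangentSpace (NonHolonomic.modelTQ E) x,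
        P.IsReactionModification Γ' → P.IsPermitted Γ' → ∀ x ∈ P.C, Γ' x = Γ x) ∧
      (∀ Γ' : ∀ x : NonHolonomic.TQ E Q, TangentSpace (NonHolonomic.modelTQ E) x,
        P.IsSODE Γ' → P.legendreGraph Γ' = P.equation ∩ P.Dhat → ∀ x ∈ P.C, Γ' x = Γ x) := by
  have hcompl : ∀ x ∈ P.C, IsCompl (P.D x) (P.forceDirections x) := fun x hx =>
    P.isCompl_map_poissonSharp (hrank x hx) (htrans x hx)
  -- The value off `C` is irrelevant and set to 0.
  have hex : ∀ x : NonHolonomic.TQ E Q, ∃ u : TangentSpace (NonHolonomic.modelTQ E) x,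
      x ∈ P.C → u ∈ P.D x ∧ ∃ f ∈ P.F x,
        u = NonHolonomic.eulerLagrangeField P.L x + NonHolonomic.poissonSharp P.L x f := by
    intro x
    by_cases hx : x ∈ P.C
    · obtain ⟨u, hu, hf⟩ := P.exists_permitted_modification (hcompl x hx)
      exact ⟨u, fun _ => ⟨hu, hf⟩⟩
    · exact ⟨0, fun h => absurd h hx⟩
  choose Γ hΓ using hex
  have hD : P.IsPermitted Γ := fun x hx => (hΓ x hx).1
  have hF : P.IsReactionModification Γ := fun x hx => (hΓ x hx).2
  have hsmooth : P.IsSmoothAlong Γ := NonHolonomic.Problem.isSmoothAlong hcompl hF hD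
  have hgraph := NonHolonomic.Problem.legendreGraph_eq hDhat hcompl hF hD
  refine ⟨NonHolonomic.Problem.compatible hF hD, P.Cstar_eq, ?_, Γ, hsmooth,
    NonHolonomic.Problem.isSODE hF, hF, hD, hgraph, fun Γ' hF' hD' x hx => ?_,
    fun Γ' hS' hg' x hx => ?_⟩
  · rw [← hgraph]
    exact NonHolonomic.Problem.isIntegrableEquation_legendreGraph hsmooth hD
  · exact P.eq_of_permitted_modification (hcompl x hx) (hD' x hx) (hD x hx) (hF' x hx) (hF x hx)
  · have hmem : P.tangentLegendre ⟨x, Γ' x⟩ ∈ P.equation ∩ P.Dhat := hg' ▸ ⟨x, hx, rfl⟩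
    exact P.eq_of_permitted_modification (hcompl x hx) (P.mem_D_of_mem_Dhat hDhat hx hmem.2)
      (hD x hx) (NonHolonomic.Problem.isReactionModification_of_isSODE hS' hx hmem.1) (hF x hx)
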